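/- **Setting.** For a finite simple graph $G$ with vertex set $V$ (one qubit and one party per vertex), the graph state $|\psi_G\rangle$ is obtained from $|+\rangle^{\otimes V}$ by a controlled-phase gate along every edge. For $\mu\in\{0,1\}^V$ let $Z_\mu$ be the product of Pauli $Z$ on the qubits with $\mu_v=1$; a graph-diagonal state is $\rho_G(\lambda)=\sum_\mu\lambda_\mu Z_\mu|\psi_G\rangle\langle\psi_G|Z_\mu$ with $\lambda$ a probability distribution. *GMPP* (genuine multipartite purification protocol), for $G$ with a proper 2-coloring $V=A\sqcup B$. Sub-protocol $P1$ takes two copies of a state; each party in $A$ applies a CNOT from the second copy to the first, each party in $B$ a CNOT from the first to the second; the second copy is measured (in the $X$-basis on $A$, the $Z$-basis on $B$), and the first copy is kept if the measured value of every stabilizer $X_a\prod_{b\sim a}Z_b$, $a\in A$, is $+1$. $P2$ is the same with $A$ and $B$ exchanged. The GMPP purifies $\rho$ if finite sequences of $P1$ and $P2$ reach fidelities with $|\psi_G\rangle$ arbitrarily close to $1$. *DRPP* (divide and rebuild protocol). For each edge, all other qubits are measured in the $Z$-basis (with the corrective local $Z$-rotations), the resulting two-qubit state is purified by the two-qubit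 recurrence protocol (a local $Z$-rotation followed by a finite sequence of $P1$, $P2$ for the single edge), and the purified pairs are merged at each vertex by the projection $|0\rangle\langle 0\cdots0|+|1\rangle\langle1\cdots1|$. The DRPP purifies $\rho$ if this reaches fidelities with $|\psi_G\rangle$ arbitrarily close to $1$. *SLOCC.* $\rho$ is purifiable by SLOCC if, for some numbers $n$ of copies and maps with finitely many product Kraus operators $\bigotimes_vK_v$, the normalized image of $\rho^{\otimes n}$ has fidelity with $|\psi_G\rangle$ arbitrarily close to $1$. **Theorem.** 1. On a graph-diagonal state, $P1$ acts, up to normalization, by $\lambda_{\mu_A,\mu_B}\mapsto\sum_{\nu_B}\lambda_{\mu_A,\nu_B}\lambda_{\mu_A,\mu_B\oplus\nu_B}$, and $P2$ by $\lambda_{\mu_A,\mu_B}\mapsto\sum_{\nu_A}\lambda_{\nu_A,\mu_B}\lambda_{\mu_A\oplus\nu_A,\mu_B}$. Hence the GMPP depends only on the sizes of the color classes and not on the geometry: if $G$, $G'$ are 2-colored graphs and $e$ is a color-preserving bijection of their vertices, then the GMPP purifies $\rho_G(\lambda)$ if and only if it purifies $\rho_{G'}(\lambda')$, where $\lambda'$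 is $\lambda$ transported along $e$. 2. Let $\rho_p$, $0\le p\le1$, be the 4-qubit linear graph state with independent $Z$-errors of probability $p$ on its two end qubits, the two inner qubits being error-free. The GMPP purifies $\rho_p$ if and only if $p<1-1/\sqrt2$ or $p>1/\sqrt2$. In particular, for $p\le 1/2$ (where the error-free component is the largest one) it purifies $\rho_p$ if $p<1-1/\sqrt2$ and does not if $p\ge1-1/\sqrt2$. 3. The DRPP purifies $\rho_p$ for every $p\in[0,1]$ with $p\ne1/2$; in particular $\rho_p$ is then purifiable by SLOCC. 4. Hence the GMPP is not optimal: for the family $\rho_p$, $0\le p\le1/2$, the infimum of the initial fidelities $\langle\psi|\rho_p|\psi\rangle$ over the $\rho_p$ that are purifiable by SLOCC (the threshold fidelity) is strictly smaller than the infimum over the $\rho_p$ that the GMPP purifies (its critical fidelity). -/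

import Mathlib

open scoped Kronecker

noncomputable section

open Classical

namespace GraphPurification

/-- Bit strings indexed by `V`: the labels of the computational basis of one qubit per element of
`V`, and also the labels of the products of Pauli `Z` operators. -/
abbrev Bits (V : Type*) := V → ZMod 2

/-- Operators (in particular density matrices) on one qubit per element of `V`. -/
abbrev Op (V : Type*) := Matrix (Bits V) (Bits V) ℂ

/-- `(-1)^a`. -/
def sgn (a : ZMod 2) : ℂ := if a = 0 then 1 else -1

/-- `ρ / Tr ρ`. -/
def normalize {n : Type*} [Fintype n] (ρ : Matrix n n ℂ) : Matrix n n ℂ :=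
  (ρ.trace)⁻¹ • ρ

/-- `⟨ψ|ρ|ψ⟩`. -/
def fidelity {n : Type*} [Fintype n] (ψ : n → ℂ) (ρ : Matrix n n ℂ) : ℝ :=
  (star ψ ⬝ᵥ ρ.mulVec ψ).re

section GraphStates

variable {V : Type*} [Fintype V]

/-- The graph state: every qubit is prepared in `|+⟩`, then a controlled-phase gate is applied
along every edge. -/
def graphState (G : SimpleGraph V) : Bits V → ℂ := fun x =>
  (((Real.sqrt 2) ^ Fintype.card V : ℝ) : ℂ)⁻¹ *
    ∏ e ∈ G.edgeFinset, (if ∀ v ∈ e, x v = 1 then -1 else 1)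

/-- The product of the Pauli `Z` operators on the qubits `v` with `μ v = 1`. -/
def pauliZ (μ : Bits V) : Op V := Matrix.diagonal fun x => sgn (∑ v, μ v * x v)

/-- The state `∑_μ c_μ Z_μ |ψ_G⟩⟨ψ_G| Z_μ`, diagonal in the graph state basis. -/
def graphDiagonal (G : SimpleGraph V) (c : Bits V → ℝ) : Op V :=
  ∑ μ, ((c μ : ℝ) : ℂ) •
    (pauliZ μ * Matrix.vecMulVec (graphState G) (star (graphState G)) * pauliZ μ)

/-- The diagonal elements of a state: a probability distribution on the error patterns. -/
def IsDistribution (c : Bits V → ℝ) : Prop := (∀ μ, 0 ≤ c μ) ∧ ∑ μ, c μ = 1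

/-- Probability of the error pattern `μ` if a `Z`-error occurs on each qubit `v` independently with
probability `q v`. -/
def zNoise (q : V → ℝ) : Bits V → ℝ := fun μ => ∏ v, if μ v = 0 then 1 - q v else q v

end GraphStates

section GMPP

variable {V : Type*} [Fintype V] {G : SimpleGraph V}

/-- The bilateral CNOT gates between two copies: for a vertex of colour `k` the second copy
controls the first, for a vertex of the other colour the first copy controls the second. -/
def cnotLayer (C : G.Coloring Bool) (k : Bool) : Matrix (Bits V × Bits V) (Bits V × Bits V) ℂ :=
  fun s t =>
    if s = (fun v => if C v = k then t.1 v + t.2 v else t.1 v,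
            fun v => if C v = k then t.2 v else t.2 v + t.1 v) then 1 else 0

/-- The bra of outcome `o` when the qubits of colour `k` are measured in the `X`-basis and the
qubits of the other colour in the `Z`-basis. -/
def outcomeBra (C : G.Coloring Bool) (k : Bool) (o : Bits V) : Bits V → ℂ := fun y =>
  ∏ v, if C v = k then ((Real.sqrt 2 : ℝ) : ℂ)⁻¹ * sgn (o v * y v)
    else if y v = o v then 1 else 0

/-- Measurement of the second copy with outcome `o`; the first copy is kept. -/
def readout (C : G.Coloring Bool) (k : Bool) (o : Bits V) : Matrix (Bits V) (Bits V × Bits V) ℂ :=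
  fun x t => if x = t.1 then outcomeBra C k o t.2 else 0

/-- The outcome `o` is kept if every stabilizer `X_v ∏_{w ~ v} Z_w` of the measured copy with `v` of
colour `k` is found to be `+1`. -/
def Accepted (C : G.Coloring Bool) (k : Bool) (o : Bits V) : Prop :=
  ∀ v, C v = k → o v + ∑ w, (if G.Adj v w then o w else 0) = 0

/-- One of the two sub-protocols of the genuine multipartite purification protocol (GMPP), acting
on two copies of `ρ`: `k` is the colour class A for `P1`, and the colour class B for `P2`. -/
def gmppStep (C : G.Coloring Bool) (k : Bool) (ρ : Op V) : Op V :=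
  normalize (∑ o ∈ Finset.univ.filter (Accepted C k),
    (readout C k o * cnotLayer C k) * (ρ ⊗ₖ ρ) * (readout C k o * cnotLayer C k).conjTranspose)

/-- A sequence of sub-protocols, in arbitrary order. -/
def gmppRun (C : G.Coloring Bool) (w : List Bool) (ρ : Op V) : Op V :=
  w.foldl (fun σ k => gmppStep C k σ) ρ

/-- The GMPP purifies `ρ` to the graph state of `G`: suitable sequences of sub-protocols reach a
fidelity arbitrarily close to one. -/
def GMPPPurifies (C : G.Coloring Bool) (ρ : Op V) : Prop :=
  ∀ ε : ℝ, 0 < ε → ∃ w : List Bool, 1 - ε < fidelity (graphState G) (gmppRun C w ρ)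

/-- The unnormalized rule `c'_{μA,μB} = ∑_{νB} c_{μA,νB} c_{μA,μB+νB}`, where A is the set of
vertices to which `C` assigns the colour `k`. No graph enters. -/
def gmppSum (C : V → Bool) (k : Bool) (c : Bits V → ℝ) : Bits V → ℝ := fun μ =>
  ∑ ν ∈ Finset.univ.filter (fun ν : Bits V => ∀ v, C v = k → ν v = μ v),
    c ν * c (fun v => if C v = k then μ v else μ v + ν v)

/-- The rule `gmppSum`, renormalized. -/
def gmppCoeff (C : V → Bool) (k : Bool) (c : Bits V → ℝ) : Bits V → ℝ := fun μ =>
  gmppSum C k c μ / ∑ κ, gmppSum C k c κ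

end GMPP

section DRPP

variable {V : Type*} [Fintype V]

/-- The bit string on `V` that is `x` on `S` and `z` off `S`. -/
def glue (S : Set V) (x : Bits S) (z : Bits (Sᶜ : Set V)) : Bits V := fun v =>
  if h : v ∈ S then x ⟨v, h⟩ else z ⟨v, h⟩

/-- All qubits outside `S` are measured in the `Z`-basis; for outcome `z` the measured qubits are
dropped and `Z` is applied to each remaining qubit `u` as often as `u` has a neighbour with
outcome one. On the graph state of `G` this gives the graph state of the induced graph. -/
def measureOut (G : SimpleGraph V) (S : Set V) (ρ : Op V) : Op S :=
  ∑ z : Bits (Sᶜ : Set V),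
    pauliZ (fun u : S => ∑ w : (Sᶜ : Set V), if G.Adj u w then z w else 0) *
      ρ.submatrix (fun x => glue S x z) (fun x => glue S x z) *
      pauliZ (fun u : S => ∑ w : (Sᶜ : Set V), if G.Adj u w then z w else 0)

/-- The two end points of an edge. -/
abbrev ends {G : SimpleGraph V} (e : G.edgeSet) : Set V := {v | v ∈ (e : Sym2 V)}

/-- The colouring of the two-qubit graph on the edge `e` that is inherited from `G`. -/
def edgeColoring {G : SimpleGraph V} (C : G.Coloring Bool) (e : G.edgeSet) :
    (G.induce (ends e)).Coloring Bool :=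
  C.comp (SimpleGraph.Embedding.induce (ends e)).toHom

/-- Purification of the pair on the edge `e`: many copies of the pair are obtained by measurement,
a local `Z`-rotation `Z_μ` is applied to choose the largest diagonal element, and the sub-protocols
in `w` of the two-qubit recurrence protocol are run. -/
def purifiedPair {G : SimpleGraph V} (C : G.Coloring Bool) (ρ : Op V) (e : G.edgeSet)
    (μ : Bits (ends e)) (w : List Bool) : Op (ends e) :=
  gmppRun (edgeColoring C e) w (pauliZ μ * measureOut G (ends e) ρ * pauliZ μ)

/-- The joint state of independent pairs, one for each edge. -/
def pairsState {G : SimpleGraph V} (σ : ∀ e : G.edgeSet, Op (ends e)) :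
    Matrix (∀ e : G.edgeSet, Bits (ends e)) (∀ e : G.edgeSet, Bits (ends e)) ℂ :=
  fun y y' => ∏ e, σ e (y e) (y' e)

/-- The tensor product over all vertices of `|0⟩⟨0…0| + |1⟩⟨1…1|`, which merges the qubits held at a
vertex (one for each incident edge) into a single qubit. -/
def merge (G : SimpleGraph V) : Matrix (Bits V) (∀ e : G.edgeSet, Bits (ends e)) ℂ :=
  fun x y => if ∀ e, ∀ v : ends e, y e v = x v then 1 else 0

/-- The graph state is rebuilt from pairs. -/
def rebuild {G : SimpleGraph V} (σ : ∀ e : G.edgeSet, Op (ends e)) : Op V :=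
  normalize (merge G * pairsState σ * (merge G).conjTranspose)

/-- The divide and rebuild purification protocol (DRPP) purifies `ρ` to the graph state of `G`: if
the pairs are purified suitably, the fidelity of the rebuilt state is arbitrarily close to one. -/
def DRPPPurifies {G : SimpleGraph V} (C : G.Coloring Bool) (ρ : Op V) : Prop :=
  ∀ ε : ℝ, 0 < ε → ∃ (μ : ∀ e : G.edgeSet, Bits (ends e)) (w : G.edgeSet → List Bool),
    1 - ε < fidelity (graphState G) (rebuild fun e => purifiedPair C ρ e (μ e) (w e))

end DRPP

section SLOCC

variable {V : Type*} [Fintype V]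

/-- `n` copies of `ρ`; the party at `v` holds the `v`-th qubit of each copy. -/
def copies (n : ℕ) (ρ : Op V) : Matrix (V → Fin n → ZMod 2) (V → Fin n → ZMod 2) ℂ :=
  fun y y' => ∏ j, ρ (fun v => y v j) (fun v => y' v j)

/-- The product operator `⊗_v K_v`, where `K_v` maps the `n` qubits of the party at `v` to a single
qubit. -/
def productOp {n : ℕ} (K : V → Matrix (ZMod 2) (Fin n → ZMod 2) ℂ) :
    Matrix (Bits V) (V → Fin n → ZMod 2) ℂ :=
  fun x y => ∏ v, K v (x v) (y v)

/-- `ρ` can be purified to `ψ` by some protocol of stochastic local operations and classical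
communication, i.e. by (unnormalized) maps with finitely many product Kraus operators on finitely
many copies. -/
def SLOCCPurifies (ψ : Bits V → ℂ) (ρ : Op V) : Prop :=
  ∀ ε : ℝ, 0 < ε → ∃ (n m : ℕ) (K : Fin m → V → Matrix (ZMod 2) (Fin n → ZMod 2) ℂ),
    1 - ε < fidelity ψ
      (normalize (∑ i, productOp (K i) * copies n ρ * (productOp (K i)).conjTranspose))

end SLOCC

/-- The linear graph on four vertices. -/
abbrev chain : SimpleGraph (Fin 4) := SimpleGraph.pathGraph 4

/-- The linear graph state of four qubits with independent `Z`-errors of probability `p` on the two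
end qubits; the two inner qubits are free of errors. -/
def noisyChain (p : ℝ) : Op (Fin 4) :=
  graphDiagonal chain (zNoise fun v => if v = 0 ∨ v = 3 then p else 0)

/-- The fidelity of the noisy chain below which it fails to satisfy `P`, where the error
probability ranges over `[0, 1/2]`: there the error-free component is the largest one. -/
def criticalFidelity (P : Op (Fin 4) → Prop) : ℝ :=
  sInf {f | ∃ p : ℝ, 0 ≤ p ∧ p ≤ 1 / 2 ∧ P (noisyChain p) ∧
    f = fidelity (graphState chain) (noisyChain p)}

end GraphPurification

end

noncomputable section

open Classical

namespace GraphPurification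

/-! ### Signs and arithmetic modulo two. -/

section Signs

/-! In the computational basis a graph-diagonal state has entries `2^(-|V|) φ(x) φ(y) ĉ(x + y)`,
where `φ` is the sign of the graph state (`phase`) and `ĉ` the Fourier transform of its weights
(`graphDiagonal_apply`). The graph enters only through `φ`. The bilateral CNOTs preserve the product
of the phases of the two copies (`phase_cnotMap`), and an accepted outcome absorbs the phase of the
measured copy (`outcomeBra_mul_phase`). What remains is a sum of products of values of `ĉ`, the
transform of a partial convolution (`sum_fourier_mul_fourier`); hence the graph-free rule and the
geometry independence.

For the noisy chain the weights form a 2×2 table, and each sub-protocol convolves it along one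
index. If no entry exceeds half of the total, this remains so (`Balanced`), and the fidelity never
exceeds 1/2. If the 00 entry exceeds half of the total, steps along the second index suppress row 1
relative to row 0 like `x^(2^n)`, while the bias between the two entries of row 0 decays only like
`y^(2^n)` with `x < y`. Then `2^m` steps' worth of squaring along the first index, with `2^m` a
little above `1 / y^(2^n)`, amplifies the bias before row 1 recovers (`exists_exponents`,
`exists_iterate_total`). The largest entry is `(1-p)^2` or `p^2`, which gives the two thresholds.

In the DRPP every edge of the chain meets at most one noisy qubit, so each pair has errors of one
colour only. A sub-protocol then merely squares the weights (`gmppSum_of_support`), and any bias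
suffices. Merging multiplies the kernels of the pairs (`fidelity_rebuild`).

Purifiability by SLOCC is proved directly, not by composing the DRPP: a local filter makes the two
error bits into parities in the computational basis, and an entrywise power of the matrix raises the
weights to that power (`endFilter_graphDiagonal`). The value `p = 2/5` separates the two critical
fidelities. -/

@[simp] lemma sgn_zero : sgn 0 = 1 := by simp [sgn]

@[simp] lemma sgn_one : sgn 1 = -1 := by simp [sgn]

lemma zmod_two_cases (a : ZMod 2) : a = 0 ∨ a = 1 := by
  revert a; decide

lemma zmod_two_add_self (a : ZMod 2) : a + a = 0 := by
  revert a; decide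

lemma sum_zmod_two {M : Type*} [AddCommMonoid M] (f : ZMod 2 → M) : ∑ a, f a = f 0 + f 1 :=
  Fin.sum_univ_two f

lemma sgn_add (a b : ZMod 2) : sgn (a + b) = sgn a * sgn b := by
  have h : (1 : ZMod 2) + 1 = 0 := by decide
  rcases zmod_two_cases a with rfl | rfl <;> rcases zmod_two_cases b with rfl | rfl <;> simp [h]

@[simp] lemma sgn_mul_self (a : ZMod 2) : sgn a * sgn a = 1 := by
  rcases zmod_two_cases a with rfl | rfl <;> simp

@[simp] lemma star_sgn (a : ZMod 2) : star (sgn a) = sgn a := by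
  rcases zmod_two_cases a with rfl | rfl <;> simp

lemma sgn_sum {ι : Type*} (s : Finset ι) (f : ι → ZMod 2) :
    sgn (∑ i ∈ s, f i) = ∏ i ∈ s, sgn (f i) := by
  induction s using Finset.induction_on with
  | empty => simp
  | insert a s ha ih => rw [Finset.sum_insert ha, Finset.prod_insert ha, sgn_add, ih]

lemma sum_sgn_mul (a : ZMod 2) : ∑ b, sgn (a * b) = if a = 0 then 2 else 0 := by
  rw [sum_zmod_two]
  rcases zmod_two_cases a with rfl | rfl
  · simp; norm_num
  · simp

lemma bits_add_self {V : Type*} (x : Bits V) : x + x = 0 := funext fun _ => zmod_two_add_self _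

lemma bits_add_cancel {V : Type*} (x y : Bits V) : x + (x + y) = y := by
  rw [← add_assoc, bits_add_self, zero_add]

end Signs

/-! ### Characters and the Fourier transform of the weights. -/

section Fourier

variable {V : Type*} [Fintype V]

/-- The sign `(-1)^{μ·x}`. -/
def chi (μ x : Bits V) : ℂ := sgn (∑ v, μ v * x v)

lemma chi_add_right (μ x y : Bits V) : chi μ (x + y) = chi μ x * chi μ y := by
  simp [chi, mul_add, Finset.sum_add_distrib, sgn_add]

lemma chi_add_left (μ ν x : Bits V) : chi (μ + ν) x = chi μ x * chi ν x := by
  simp [chi, add_mul, Finset.sum_add_distrib, sgn_add]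

@[simp] lemma chi_zero_right (μ : Bits V) : chi μ 0 = 1 := by simp [chi]

@[simp] lemma chi_zero_left (μ : Bits V) : chi 0 μ = 1 := by simp [chi]

@[simp] lemma chi_mul_self (μ x : Bits V) : chi μ x * chi μ x = 1 := by simp [chi]

/-- Character sum over the bit strings supported on `p`. -/
lemma sum_chi_supported (p : V → Prop) (μ : Bits V) :
    ∑ z ∈ Finset.univ.filter (fun z : Bits V => ∀ v, ¬ p v → z v = 0), chi μ z =
      if ∀ v, p v → μ v = 0 then ∏ v, (if p v then 2 else 1) else 0 := by
  have h1 : ∀ z : Bits V, (if ∀ v, ¬ p v → z v = 0 then chi μ z else 0) =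
      ∏ v, (if ¬ p v → z v = 0 then sgn (μ v * z v) else 0) := by
    intro z
    split_ifs with h
    · rw [chi, sgn_sum]
      exact Finset.prod_congr rfl fun v _ => by rw [if_pos (h v)]
    · push Not at h
      obtain ⟨v, hv, hz⟩ := h
      exact (Finset.prod_eq_zero (Finset.mem_univ v) (by simp [hv, hz])).symm
  rw [Finset.sum_filter, Finset.sum_congr rfl fun z _ => h1 z]
  -- The character sum factorizes over the vertices.
  have h2 := (Finset.prod_univ_sum (fun _ : V => (Finset.univ : Finset (ZMod 2)))
    (fun v a => if ¬ p v → a = 0 then sgn (μ v * a) else 0)).symm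
  rw [Fintype.piFinset_univ] at h2
  rw [h2]
  have h3 : ∀ v, (∑ a : ZMod 2, (if ¬ p v → a = 0 then sgn (μ v * a) else 0)) =
      if p v then (if μ v = 0 then 2 else 0) else 1 := by
    intro v
    by_cases hp : p v
    · simp only [hp, not_true_eq_false, false_imp_iff, if_true]
      exact sum_sgn_mul _
    · simp [hp]
  rw [Finset.prod_congr rfl fun v _ => h3 v]
  split_ifs with h
  · refine Finset.prod_congr rfl fun v _ => ?_
    by_cases hp : p v <;> simp [hp]
    exact h v hp
  · push Not at h
    obtain ⟨v, hv, hz⟩ := h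
    exact Finset.prod_eq_zero (Finset.mem_univ v) (by simp [hv, hz])

lemma sum_chi (μ : Bits V) : ∑ z, chi μ z = if μ = 0 then 2 ^ Fintype.card V else 0 := by
  have h := sum_chi_supported (fun _ : V => True) μ
  simp only [not_true_eq_false, false_imp_iff, implies_true, Finset.filter_true, true_imp_iff,
    if_true, Finset.prod_const, Finset.card_univ] at h
  rw [h]
  simp [funext_iff]

/-- The Fourier transform of the diagonal elements. -/
def fourier (c : Bits V → ℝ) (z : Bits V) : ℂ := ∑ μ, (c μ : ℂ) * chi μ z

lemma fourier_zero (c : Bits V → ℝ) : fourier c 0 = ((∑ μ, c μ : ℝ) : ℂ) := by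
  simp [fourier]

lemma sum_fourier (c : Bits V → ℝ) : ∑ z, fourier c z = 2 ^ Fintype.card V * (c 0 : ℂ) := by
  unfold fourier
  rw [Finset.sum_comm]
  simp_rw [← Finset.mul_sum, sum_chi]
  simp [mul_comm]

end Fourier

/-! ### Graph-diagonal states as kernels in the computational basis. -/

section States

variable {V : Type*} [Fintype V]

/-- The sign of the graph state at a computational basis vector. -/
def phase (G : SimpleGraph V) (x : Bits V) : ℂ :=
  ∏ e ∈ G.edgeFinset, (if ∀ v ∈ e, x v = 1 then -1 else 1)

lemma phase_mul_self (G : SimpleGraph V) (x : Bits V) : phase G x * phase G x = 1 := by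
  rw [phase, ← Finset.prod_mul_distrib]
  refine Finset.prod_eq_one fun e _ => ?_
  split_ifs <;> simp

lemma star_phase (G : SimpleGraph V) (x : Bits V) : star (phase G x) = phase G x := by
  rw [phase, star_prod]
  refine Finset.prod_congr rfl fun e _ => ?_
  split_ifs <;> simp

/-- The normalization of the graph state. -/
def amp (V : Type*) [Fintype V] : ℂ := (((Real.sqrt 2) ^ Fintype.card V : ℝ) : ℂ)⁻¹

lemma amp_mul_self : amp V * amp V = (2 ^ Fintype.card V)⁻¹ := by
  rw [amp, ← mul_inv, ← Complex.ofReal_mul, ← mul_pow, Real.mul_self_sqrt (by norm_num)]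
  simp

lemma star_amp : star (amp V) = amp V := by
  rw [amp, star_inv₀]
  simp

lemma graphState_apply (G : SimpleGraph V) (x : Bits V) : graphState G x = amp V * phase G x := rfl

lemma star_graphState (G : SimpleGraph V) : star (graphState G) = graphState G := by
  funext x
  rw [Pi.star_apply, graphState_apply, star_mul, star_amp, star_phase, mul_comm]

/-- Conjugation by `Z_μ` multiplies the `(x, y)` entry by `chi μ (x + y)`. All later computations
with states go through this formula. -/
lemma graphDiagonal_apply (G : SimpleGraph V) (c : Bits V → ℝ) (x y : Bits V) :
    graphDiagonal G c x y =
      (2 ^ Fintype.card V)⁻¹ * (phase G x * phase G y) * fourier c (x + y) := by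
  have h : ∀ μ : Bits V, ((pauliZ μ * Matrix.vecMulVec (graphState G) (star (graphState G)) *
      pauliZ μ) x y : ℂ) = amp V * amp V * (phase G x * phase G y) * chi μ (x + y) := by
    intro μ
    rw [pauliZ, Matrix.mul_diagonal, Matrix.diagonal_mul, Matrix.vecMulVec_apply, star_graphState,
      chi_add_right, graphState_apply, graphState_apply, chi, chi]
    ring
  rw [graphDiagonal, Matrix.sum_apply, fourier, Finset.mul_sum]
  refine Finset.sum_congr rfl fun μ _ => ?_
  rw [Matrix.smul_apply, h, amp_mul_self, smul_eq_mul]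
  ring

lemma trace_graphDiagonal (G : SimpleGraph V) (c : Bits V → ℝ) :
    (graphDiagonal G c).trace = ((∑ μ, c μ : ℝ) : ℂ) := by
  simp_rw [Matrix.trace, Matrix.diag_apply, graphDiagonal_apply, phase_mul_self, bits_add_self,
    fourier_zero]
  simp

lemma graphDiagonal_smul (G : SimpleGraph V) (t : ℝ) (c : Bits V → ℝ) :
    graphDiagonal G (fun μ => t * c μ) = (t : ℂ) • graphDiagonal G c := by
  simp only [graphDiagonal, Finset.smul_sum, smul_smul, Complex.ofReal_mul]

/-- The overlap of the graph state with a matrix given by signs and a function of the sum. -/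
lemma fidelity_graphState (G : SimpleGraph V) (F : Bits V → ℂ) (t : ℂ) (ρ : Op V)
    (hρ : ∀ x y, ρ x y = t * (phase G x * phase G y) * F (x + y)) :
    fidelity (graphState G) ρ = (t * ∑ z, F z).re := by
  rw [fidelity, star_graphState]
  congr 1
  simp only [dotProduct, Matrix.mulVec, graphState_apply, Finset.mul_sum, hρ]
  have h : ∀ x : Bits V, ∑ y, amp V * phase G x * (t * (phase G x * phase G y) * F (x + y) *
      (amp V * phase G y)) = (2 ^ Fintype.card V)⁻¹ * ∑ z, t * F z := by
    intro x
    rw [Finset.mul_sum,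
      ← Equiv.sum_comp (Equiv.addLeft x) fun z => (2 ^ Fintype.card V)⁻¹ * (t * F z)]
    refine Finset.sum_congr rfl fun y _ => ?_
    have e1 := phase_mul_self G x
    have e2 := phase_mul_self G y
    have e3 : amp V * amp V = _ := amp_mul_self
    simp only [Equiv.coe_addLeft]
    rw [← e3]
    linear_combination (amp V * amp V * t * F (x + y)) *
      ((phase G y * phase G y) * e1 + e2)
  rw [Finset.sum_congr rfl fun x _ => h x]
  simp

/-- The `Fintype` instance is arbitrary, here and in later lemmas, so that they apply whichever
decidable equality it was built from. -/
lemma fidelity_graphDiagonal {inst : Fintype (Bits V)} (G : SimpleGraph V) (c : Bits V → ℝ) :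
    fidelity (graphState G) (graphDiagonal G c) = c 0 := by
  rw [Subsingleton.elim inst Pi.instFintype]
  rw [fidelity_graphState G _ _ _ (graphDiagonal_apply G c), sum_fourier,
    inv_mul_cancel_left₀ (pow_ne_zero _ two_ne_zero), Complex.ofReal_re]

lemma normalize_smul {n : Type*} {_ : Fintype n} (t : ℂ) (ht : t ≠ 0) (ρ : Matrix n n ℂ) :
    normalize (t • ρ) = normalize ρ := by
  rw [normalize, normalize, Matrix.trace_smul, smul_smul, smul_eq_mul, mul_inv, mul_right_comm,
    inv_mul_cancel₀ ht, one_mul]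

lemma normalize_graphDiagonal (G : SimpleGraph V) (c : Bits V → ℝ) :
    normalize (graphDiagonal G c) = graphDiagonal G (fun μ => c μ / ∑ κ, c κ) := by
  rw [normalize, trace_graphDiagonal, ← Complex.ofReal_inv, ← graphDiagonal_smul]
  simp [div_eq_inv_mul]

end States

/-! ### The phase as a quadratic form. -/

section Phases

variable {V : Type*} [Fintype V] {G : SimpleGraph V}

lemma edgeSign_mk (x : Bits V) (v w : V) :
    (if ∀ u ∈ s(v, w), x u = 1 then (-1 : ℂ) else 1) = sgn (x v * x w) := by
  simp only [Sym2.mem_iff, forall_eq_or_imp, forall_eq]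
  rcases zmod_two_cases (x v) with h | h <;> rcases zmod_two_cases (x w) with h' | h' <;>
    simp [h, h']

/-- Each edge has exactly one end of colour `k`, so it corresponds to one ordered pair. -/
lemma prod_edgeFinset (C : G.Coloring Bool) (k : Bool) (F : Sym2 V → ℂ) :
    ∏ e ∈ G.edgeFinset, F e = ∏ v, ∏ w, if C v = k ∧ G.Adj v w then F s(v, w) else 1 := by
  rw [← Fintype.prod_prod_type' fun v w => if C v = k ∧ G.Adj v w then F s(v, w) else 1,
    ← Finset.prod_filter (fun q : V × V => C q.1 = k ∧ G.Adj q.1 q.2) fun q => F s(q.1, q.2)]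
  symm
  refine Finset.prod_nbij (fun q : V × V => s(q.1, q.2)) ?_ ?_ ?_ fun _ _ => rfl
  · rintro ⟨v, w⟩ h
    simpa using (Finset.mem_filter.1 h).2.2
  · rintro ⟨v, w⟩ h ⟨v', w'⟩ h' e
    have h := (Finset.mem_filter.1 h).2
    have h' := (Finset.mem_filter.1 h').2
    simp only [Sym2.eq_iff] at e
    rcases e with ⟨rfl, rfl⟩ | ⟨rfl, rfl⟩
    · rfl
    · exact absurd (h.1.trans h'.1.symm) (C.valid h.2)
  · intro e
    induction e using Sym2.ind with
    | _ v w =>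
      intro h
      have h : G.Adj v w := by simpa using h
      by_cases hv : C v = k
      · exact ⟨(v, w), by simp [hv, h], rfl⟩
      · have hw : C w = k := by
          have := C.valid h
          revert this hv
          generalize C v = a; generalize C w = b
          revert a b k; decide
        exact ⟨(w, v), by simp [hw, h.symm], Sym2.eq_swap⟩

/-- The exponent of `-1` in the graph state of a two-coloured graph. -/
def quadForm (C : G.Coloring Bool) (k : Bool) (x : Bits V) : ZMod 2 :=
  ∑ v, ∑ w, if C v = k ∧ G.Adj v w then x v * x w else 0

lemma phase_eq_sgn (C : G.Coloring Bool) (k : Bool) (x : Bits V) :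
    phase G x = sgn (quadForm C k x) := by
  rw [phase, prod_edgeFinset C k, quadForm, sgn_sum]
  refine Finset.prod_congr rfl fun v _ => ?_
  rw [sgn_sum]
  refine Finset.prod_congr rfl fun w _ => ?_
  rw [edgeSign_mk]
  split_ifs
  · rfl
  · exact sgn_zero.symm

end Phases

/-! ### The convolution identity behind the sub-protocols. -/

section Mixing

variable {V : Type*}

/-- The bit string that is `a` where `p` holds and `b` elsewhere. -/
def mix (p : V → Prop) (a b : Bits V) : Bits V := fun v => if p v then a v else b v

/-- The bit strings that vanish where `p` fails. -/
def supportedOn [Fintype V] (p : V → Prop) : Finset (Bits V) :=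
  Finset.univ.filter fun z => ∀ v, ¬ p v → z v = 0

lemma mem_supportedOn [Fintype V] {p : V → Prop} {z : Bits V} :
    z ∈ supportedOn p ↔ ∀ v, ¬ p v → z v = 0 := by
  simp [supportedOn]

lemma mix_add (p : V → Prop) (a b c d : Bits V) :
    mix p a b + mix p c d = mix p (a + c) (b + d) := by
  funext v
  by_cases h : p v <;> simp [mix, h]

lemma chi_mix_zero [Fintype V] (p : V → Prop) (a b : Bits V) :
    chi (mix p 0 a) b = chi a (mix p 0 b) := by
  unfold chi mix
  congr 1
  refine Finset.sum_congr rfl fun v _ => ?_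
  by_cases h : p v <;> simp [h]

/-- Fourier transform of the rule for the diagonal elements. -/
lemma sum_fourier_mul_fourier [Fintype V] (C : V → Bool) (k : Bool) (c : Bits V → ℝ) (w : Bits V) :
    ∑ z ∈ supportedOn (C · = k), fourier c (w + z) * fourier c (mix (C · = k) z w) =
      (∏ v, (if C v = k then 2 else 1)) * fourier (gmppSum C k c) w := by
  set p : V → Prop := (C · = k) with hp
  set P : ℂ := ∏ v, (if C v = k then 2 else 1) with hP
  have h1 : ∀ z ∈ supportedOn p, fourier c (w + z) * fourier c (mix p z w) =
      ∑ ν, ∑ μ, (c μ * c ν * (chi μ w * chi ν (mix p 0 w))) * chi (μ + ν) z := by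
    intro z hz
    have e : mix p z w = z + mix p 0 w := by
      funext v
      by_cases h : p v
      · simp [mix, h]
      · simp [mix, h, mem_supportedOn.1 hz v h]
    rw [fourier, fourier, Finset.sum_mul_sum, Finset.sum_comm, e]
    refine Finset.sum_congr rfl fun ν _ => Finset.sum_congr rfl fun μ _ => ?_
    rw [chi_add_right, chi_add_right, chi_add_left]
    ring
  rw [Finset.sum_congr rfl h1, Finset.sum_comm]
  -- Orthogonality of characters keeps only the pairs that agree on colour `k`.
  have h2 : ∀ μ ν : Bits V, ∑ z ∈ supportedOn p,
      ((c μ * c ν * (chi μ w * chi ν (mix p 0 w))) * chi (μ + ν) z : ℂ) =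
      if ∀ v, p v → ν v = μ v then P * (c μ * c ν * (chi μ w * chi ν (mix p 0 w))) else 0 := by
    intro μ ν
    rw [← Finset.mul_sum, supportedOn, sum_chi_supported]
    have : (∀ v, p v → (μ + ν) v = 0) ↔ ∀ v, p v → ν v = μ v := by
      refine forall_congr' fun v => imp_congr_right fun _ => ?_
      rw [Pi.add_apply]
      generalize μ v = a; generalize ν v = b
      revert a b; decide
    simp only [this]
    split_ifs
    · rw [mul_comm, hP]
      congr 1
      exact Finset.prod_congr rfl fun v _ => by congr
    · rw [mul_zero]
  have h3 : ∀ ν, ∑ z ∈ supportedOn p,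
      ∑ μ, ((c μ * c ν * (chi μ w * chi ν (mix p 0 w))) * chi (μ + ν) z : ℂ) =
      ∑ κ, if ∀ v, p v → ν v = κ v then
        P * (c ν * c (mix p κ (κ + ν)) * chi κ w) else 0 := by
    intro ν
    rw [Finset.sum_comm, Finset.sum_congr rfl fun μ _ => h2 μ ν]
    -- Substitute `μ = κ + ν` off colour `k`, so that `κ` becomes the error pattern of the kept
    -- copy.
    have inv : Function.Involutive fun κ : Bits V => mix p κ (κ + ν) := by
      intro κ
      funext v
      by_cases h : p v
      · simp [mix, h]
      · simp [mix, h, add_assoc, zmod_two_add_self]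
    rw [← Equiv.sum_comp inv.toPerm]
    refine Finset.sum_congr rfl fun κ _ => ?_
    simp only [Function.Involutive.coe_toPerm]
    have e1 : (∀ v, p v → ν v = mix p κ (κ + ν) v) ↔ ∀ v, p v → ν v = κ v :=
      forall_congr' fun v => imp_congr_right fun h => by simp [mix, h]
    have e2 : mix p κ (κ + ν) = κ + mix p 0 ν := by
      funext v
      by_cases h : p v <;> simp [mix, h]
    simp only [e1]
    split_ifs
    · have e3 := chi_mul_self ν (mix p 0 w)
      rw [e2, chi_add_left, chi_mix_zero]
      linear_combination P * c (κ + mix p 0 ν) * c ν * chi κ w * e3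
    · rfl
  rw [Finset.sum_congr rfl fun ν _ => h3 ν, Finset.sum_comm, fourier, Finset.mul_sum]
  refine Finset.sum_congr rfl fun κ _ => ?_
  rw [gmppSum, Complex.ofReal_sum, Finset.sum_mul, Finset.mul_sum, Finset.sum_filter]
  refine Finset.sum_congr rfl fun ν _ => ?_
  have e : mix p κ (κ + ν) = fun v => if C v = k then κ v else κ v + ν v := by
    funext v
    by_cases h : C v = k <;> simp [mix, hp, h]
  rw [e]
  simp only [Complex.ofReal_mul, hp, mul_assoc]

end Mixing

/-! ### One sub-protocol on a graph-diagonal state. -/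

section Step

variable {V : Type*} [Fintype V] {G : SimpleGraph V}

/-- The action of the bilateral CNOT gates on computational basis vectors. -/
def cnotMap {V : Type*} (C : V → Bool) (k : Bool) (t : Bits V × Bits V) : Bits V × Bits V :=
  (mix (C · = k) (t.1 + t.2) t.1, mix (C · = k) t.2 (t.2 + t.1))

lemma cnotMap_involutive {V : Type*} (C : V → Bool) (k : Bool) :
    Function.Involutive (cnotMap C k) := by
  rintro ⟨x, y⟩
  ext v
  · by_cases h : C v = k <;> simp [cnotMap, mix, h, add_assoc, zmod_two_add_self]
  · by_cases h : C v = k <;> simp [cnotMap, mix, h, add_assoc, zmod_two_add_self]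

lemma kraus_apply (C : G.Coloring Bool) (k : Bool) (o x : Bits V) (t : Bits V × Bits V) :
    (readout C k o * cnotLayer C k) x t =
      if x = (cnotMap C k t).1 then outcomeBra C k o (cnotMap C k t).2 else 0 := by
  have h : ∀ s, cnotLayer C k s t = if s = cnotMap C k t then 1 else 0 := fun s => by
    have e : cnotMap C k t = (fun v => if C v = k then t.1 v + t.2 v else t.1 v,
        fun v => if C v = k then t.2 v else t.2 v + t.1 v) := by
      ext v <;> by_cases hv : C v = k <;> simp [cnotMap, mix, hv]
    rw [e]
    rfl
  rw [Matrix.mul_apply]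
  simp only [h, mul_ite, mul_one, mul_zero, Finset.sum_ite_eq', Finset.mem_univ, if_true]
  rfl

lemma sum_kraus_mul (C : G.Coloring Bool) (k : Bool) (o x : Bits V) (g : Bits V × Bits V → ℂ) :
    ∑ t, (readout C k o * cnotLayer C k) x t * g t =
      ∑ y, outcomeBra C k o y * g (cnotMap C k (x, y)) := by
  rw [← Equiv.sum_comp (cnotMap_involutive C k).toPerm, Fintype.sum_prod_type, Finset.sum_comm]
  refine Finset.sum_congr rfl fun y _ => ?_
  simp only [kraus_apply, Function.Involutive.coe_toPerm, (cnotMap_involutive C k) _, ite_mul,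
    zero_mul, Finset.sum_ite_eq, Finset.mem_univ, if_true]

/-- On an edge with `v` of colour `k` and `w` of the other, the exponent becomes `(x_v + y_v) x_w +
y_v (y_w + x_w)`, whose cross terms cancel modulo 2. -/
lemma phase_cnotMap (C : G.Coloring Bool) (k : Bool) (x y : Bits V) :
    phase G (cnotMap C k (x, y)).1 * phase G (cnotMap C k (x, y)).2 = phase G x * phase G y := by
  rw [phase_eq_sgn C k, phase_eq_sgn C k, phase_eq_sgn C k, phase_eq_sgn C k, ← sgn_add,
    ← sgn_add]
  congr 1
  simp only [quadForm, ← Finset.sum_add_distrib]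
  refine Finset.sum_congr rfl fun v _ => Finset.sum_congr rfl fun w _ => ?_
  split_ifs with h
  · have hw : C w ≠ k := fun e => C.valid h.2 (h.1.trans e.symm)
    simp only [cnotMap, mix, h.1, hw, if_true, if_false, Pi.add_apply]
    generalize x v = a; generalize x w = b; generalize y v = c; generalize y w = d
    revert a b c d; decide
  · simp

/-- The norm of the bras of the `X`-measurement. -/
def braNorm (C : V → Bool) (k : Bool) : ℂ :=
  ∏ v, if C v = k then ((Real.sqrt 2 : ℝ) : ℂ)⁻¹ else 1

lemma braNorm_ne_zero (C : V → Bool) (k : Bool) : braNorm C k ≠ 0 := by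
  refine Finset.prod_ne_zero_iff.2 fun v _ => ?_
  split_ifs <;> simp

lemma star_outcomeBra (C : G.Coloring Bool) (k : Bool) (o y : Bits V) :
    star (outcomeBra C k o y) = outcomeBra C k o y := by
  rw [outcomeBra, star_prod]
  refine Finset.prod_congr rfl fun v _ => ?_
  split_ifs
  · rw [star_mul, star_sgn, star_inv₀, mul_comm]
    simp
  · simp
  · simp

/-- Once `y` is fixed to `o` off colour `k`, the phase is linear in the remaining bits; acceptance
says that its coefficients are `o v`, so it cancels the sign of the `X`-basis bra. -/
lemma outcomeBra_mul_phase (C : G.Coloring Bool) (k : Bool) {o : Bits V} (ho : Accepted C k o)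
    (y : Bits V) :
    outcomeBra C k o y * phase G y =
      if ∀ v, ¬ C v = k → y v = o v then braNorm C k else 0 := by
  split_ifs with h
  · rw [phase_eq_sgn C k, quadForm, sgn_sum, outcomeBra, ← Finset.prod_mul_distrib]
    refine Finset.prod_congr rfl fun v _ => ?_
    by_cases hv : C v = k
    · have e : ∑ w, (if C v = k ∧ G.Adj v w then y v * y w else 0) = o v * y v := by
        have e1 : ∀ w, (if C v = k ∧ G.Adj v w then y v * y w else 0) =
            y v * (if G.Adj v w then o w else 0) := by
          intro w
          by_cases hw : G.Adj v w
          · simp [hv, hw, h w fun e => C.valid hw (hv.trans e.symm)]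
          · simp [hw]
        rw [Finset.sum_congr rfl fun w _ => e1 w, ← Finset.mul_sum]
        have e2 := ho v hv
        revert e2
        generalize (∑ w, if G.Adj v w then o w else 0) = a
        generalize o v = b; generalize y v = d
        revert a b d; decide
      rw [e]
      simp [hv, mul_assoc]
    · simp [hv, h v hv]
  · push Not at h
    obtain ⟨v, hv, hy⟩ := h
    rw [outcomeBra, Finset.prod_eq_zero (Finset.mem_univ v) (by simp [hv, hy]), zero_mul]

lemma kraus_conj_apply (C : G.Coloring Bool) (k : Bool) (o : Bits V) (ρ : Op V) (x x' : Bits V) :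
    ((readout C k o * cnotLayer C k) * (ρ ⊗ₖ ρ) *
      (readout C k o * cnotLayer C k).conjTranspose) x x' =
    ∑ y', ∑ y, outcomeBra C k o y * outcomeBra C k o y' *
      (ρ (cnotMap C k (x, y)).1 (cnotMap C k (x', y')).1 *
        ρ (cnotMap C k (x, y)).2 (cnotMap C k (x', y')).2) := by
  rw [Matrix.mul_apply]
  have h : ∀ t', ((readout C k o * cnotLayer C k) * (ρ ⊗ₖ ρ)) x t' =
      ∑ y, outcomeBra C k o y * (ρ ⊗ₖ ρ) (cnotMap C k (x, y)) t' := fun t' => by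
    rw [Matrix.mul_apply, sum_kraus_mul C k o x fun t => (ρ ⊗ₖ ρ) t t']
  have h' : ∀ t', (readout C k o * cnotLayer C k).conjTranspose t' x' =
      (readout C k o * cnotLayer C k) x' t' := fun t' => by
    rw [Matrix.conjTranspose_apply, kraus_apply]
    split_ifs
    · exact star_outcomeBra C k o _
    · exact star_zero _
  simp only [h, h']
  rw [Finset.sum_congr rfl fun t' _ => mul_comm _ _, sum_kraus_mul C k o x' fun t' =>
    ∑ y, outcomeBra C k o y * (ρ ⊗ₖ ρ) (cnotMap C k (x, y)) t']
  refine Finset.sum_congr rfl fun y' _ => ?_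
  rw [Finset.mul_sum]
  refine Finset.sum_congr rfl fun y _ => ?_
  rw [Matrix.kronecker_apply]
  ring

lemma accepted_zero (C : G.Coloring Bool) (k : Bool) : Accepted C k 0 := fun v _ => by simp

/-- The outcome affects only a positive count, so all accepted outcomes yield the same state up to a
scalar. -/
lemma kraus_graphDiagonal (C : G.Coloring Bool) (k : Bool) (c : Bits V → ℝ) {o : Bits V}
    (ho : Accepted C k o) :
    (readout C k o * cnotLayer C k) * (graphDiagonal G c ⊗ₖ graphDiagonal G c) *
      (readout C k o * cnotLayer C k).conjTranspose =
    (((Finset.univ.filter fun y : Bits V => ∀ v, ¬ C v = k → y v = o v).card : ℂ) *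
      ((2 ^ Fintype.card V)⁻¹ * braNorm C k ^ 2 * ∏ v, (if C v = k then 2 else 1))) •
      graphDiagonal G (gmppSum C k c) := by
  ext x x'
  set D : ℂ := (2 ^ Fintype.card V)⁻¹ with hD
  set b := braNorm C k with hb
  set p : V → Prop := (C · = k) with hp
  rw [kraus_conj_apply, Matrix.smul_apply, graphDiagonal_apply, smul_eq_mul]
  have h1 : ∀ y y', outcomeBra C k o y * outcomeBra C k o y' *
      (graphDiagonal G c (cnotMap C k (x, y)).1 (cnotMap C k (x', y')).1 *
        graphDiagonal G c (cnotMap C k (x, y)).2 (cnotMap C k (x', y')).2) =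
      if ∀ v, ¬ p v → y' v = o v then if ∀ v, ¬ p v → y v = o v then
        D ^ 2 * b ^ 2 * (phase G x * phase G x') *
          (fourier c (x + x' + (y' + y)) * fourier c (mix p (y' + y) (x + x'))) else 0 else 0 := by
    intro y y'
    have e1 := phase_cnotMap C k x y
    have e2 := phase_cnotMap C k x' y'
    have e3 := outcomeBra_mul_phase C k ho y
    have e4 := outcomeBra_mul_phase C k ho y'
    rw [graphDiagonal_apply, graphDiagonal_apply]
    set f1 := fourier c ((cnotMap C k (x, y)).1 + (cnotMap C k (x', y')).1) with hf1
    set f2 := fourier c ((cnotMap C k (x, y)).2 + (cnotMap C k (x', y')).2) with hf2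
    -- Exchange the phases after the CNOTs for those before, and pair the measured ones with the
    -- bras.
    trans D ^ 2 * (phase G x * phase G x') * (f1 * f2) *
        ((outcomeBra C k o y * phase G y) * (outcomeBra C k o y' * phase G y'))
    · linear_combination (outcomeBra C k o y * outcomeBra C k o y' * D ^ 2 * f1 * f2) *
        (phase G (cnotMap C k (x', y')).1 * phase G (cnotMap C k (x', y')).2 * e1 +
          phase G x * phase G y * e2)
    · rw [e3, e4]
      by_cases hy : ∀ v, ¬ p v → y v = o v
      · by_cases hy' : ∀ v, ¬ p v → y' v = o v
        · rw [if_pos hy, if_pos hy', if_pos hy, if_pos hy', hf1, hf2]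
          have g1 : (cnotMap C k (x, y)).1 + (cnotMap C k (x', y')).1 = x + x' + (y' + y) := by
            funext v
            by_cases h : p v
            · simp only [cnotMap, mix_add]
              have : C v = k := h
              simp only [mix, this, if_true, Pi.add_apply]
              ring
            · have h0 : ¬ C v = k := h
              simp [cnotMap, mix, h0, hy v h, hy' v h, zmod_two_add_self]
          have g2 : (cnotMap C k (x, y)).2 + (cnotMap C k (x', y')).2 =
              mix p (y' + y) (x + x') := by
            funext v
            by_cases h : p v
            · have h0 : C v = k := h
              simp [cnotMap, mix, h0, h, add_comm]
            · have h0 : ¬ C v = k := h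
              simp only [cnotMap, mix, h0, h, hy v h, hy' v h, if_false, Pi.add_apply]
              generalize o v = a; generalize x v = b; generalize x' v = d
              revert a b d; decide
          rw [g1, g2]
          ring
        · rw [if_neg hy', if_neg hy', mul_zero, mul_zero]
      · rw [if_neg hy, zero_mul, mul_zero]
        simp [hy]
  simp only [h1]
  have h2 : ∀ y' : Bits V, (∑ y : Bits V, if ∀ v, ¬ p v → y' v = o v then
      if ∀ v, ¬ p v → y v = o v then
        D ^ 2 * b ^ 2 * (phase G x * phase G x') *
          (fourier c (x + x' + (y' + y)) * fourier c (mix p (y' + y) (x + x'))) else 0 else 0) =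
      if ∀ v, ¬ p v → y' v = o v then D ^ 2 * b ^ 2 * (phase G x * phase G x') *
        ((∏ v, (if C v = k then 2 else 1)) * fourier (gmppSum C k c) (x + x')) else 0 := by
    intro y'
    split_ifs with hy'
    · rw [← sum_fourier_mul_fourier, Finset.mul_sum, ← Equiv.sum_comp (Equiv.addLeft y'),
        supportedOn, Finset.sum_filter]
      refine Finset.sum_congr rfl fun z _ => ?_
      simp only [Equiv.coe_addLeft, bits_add_cancel]
      have : (∀ v, ¬ p v → (y' + z) v = o v) ↔ ∀ v, ¬ C v = k → z v = 0 := by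
        refine forall_congr' fun v => imp_congr_right fun h => ?_
        rw [Pi.add_apply, hy' v h]
        exact add_eq_left
      by_cases hz : ∀ v, ¬ C v = k → z v = 0
      · rw [if_pos (this.2 hz), if_pos hz]
      · rw [if_neg (this.not.2 hz), if_neg hz]
    · exact Finset.sum_const_zero
  simp only [h2]
  rw [← Finset.sum_filter, Finset.sum_const, nsmul_eq_mul]
  ring

/-- The sub-protocols act on the diagonal elements by a rule in which no graph enters. -/
lemma gmppStep_graphDiagonal (C : G.Coloring Bool) (k : Bool) (c : Bits V → ℝ) :
    gmppStep C k (graphDiagonal G c) = graphDiagonal G (gmppCoeff C k c) := by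
  rw [gmppStep, Finset.sum_congr rfl fun o ho =>
    kraus_graphDiagonal C k c (Finset.mem_filter.1 ho).2, ← Finset.sum_smul, ← Finset.sum_mul,
    ← Nat.cast_sum, normalize_smul, normalize_graphDiagonal]
  · rfl
  -- The scalar is nonzero because the outcome `0` is always accepted.
  refine mul_ne_zero (Nat.cast_ne_zero.2 (Finset.sum_pos' (fun _ _ => Nat.zero_le _)
    ⟨0, Finset.mem_filter.2 ⟨Finset.mem_univ _, accepted_zero C k⟩,
      Finset.card_pos.2 ⟨0, Finset.mem_filter.2 ⟨Finset.mem_univ _, fun _ _ => rfl⟩⟩⟩).ne') ?_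
  refine mul_ne_zero (mul_ne_zero (inv_ne_zero (pow_ne_zero _ two_ne_zero))
    (pow_ne_zero _ (braNorm_ne_zero C k))) (Finset.prod_ne_zero_iff.2 fun v _ => ?_)
  split_ifs <;> norm_num

/-- The diagonal elements after a sequence of sub-protocols. -/
def coeffRun (C : V → Bool) (w : List Bool) (c : Bits V → ℝ) : Bits V → ℝ :=
  w.foldl (fun d k => gmppCoeff C k d) c

lemma gmppRun_graphDiagonal (C : G.Coloring Bool) (w : List Bool) (c : Bits V → ℝ) :
    gmppRun C w (graphDiagonal G c) = graphDiagonal G (coeffRun C w c) := by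
  induction w generalizing c with
  | nil => rfl
  | cons k w ih =>
    rw [gmppRun, List.foldl_cons, gmppStep_graphDiagonal]
    exact ih _

lemma gmppPurifies_graphDiagonal (C : G.Coloring Bool) (c : Bits V → ℝ) :
    GMPPPurifies C (graphDiagonal G c) ↔
      ∀ ε : ℝ, 0 < ε → ∃ w : List Bool, 1 - ε < coeffRun C w c 0 := by
  simp only [GMPPPurifies, gmppRun_graphDiagonal, fidelity_graphDiagonal]

end Step

/-! ### Invariance under colour-preserving bijections. -/

section Transport

variable {V W : Type*} [Fintype V] [Fintype W]

lemma gmppSum_transport {C : V → Bool} {D : W → Bool} (e : V ≃ W) (h : ∀ v, D (e v) = C v)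
    (k : Bool) (c : Bits V → ℝ) (κ : Bits W) :
    gmppSum D k (fun κ => c fun v => κ (e v)) κ = gmppSum C k c fun v => κ (e v) := by
  have h' : ∀ w, C (e.symm w) = D w := fun w => by rw [← h, e.apply_symm_apply]
  unfold gmppSum
  refine Finset.sum_equiv (Equiv.arrowCongr e.symm (Equiv.refl _)) ?_ ?_
  · intro ν
    simp only [Finset.mem_filter, Finset.mem_univ, true_and, Equiv.arrowCongr_apply,
      Equiv.symm_symm, Function.comp_apply, Equiv.coe_refl, id_eq]
    rw [← e.forall_congr_right (q := fun w => D w = k → ν w = κ w)]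
    simp only [h]
  · intro ν _
    simp only [h]
    rfl

lemma coeffRun_transport {C : V → Bool} {D : W → Bool} (e : V ≃ W) (h : ∀ v, D (e v) = C v)
    (w : List Bool) (c : Bits V → ℝ) :
    coeffRun D w (fun κ => c fun v => κ (e v)) = fun κ => coeffRun C w c fun v => κ (e v) := by
  induction w generalizing c with
  | nil => rfl
  | cons k w ih =>
    have : gmppCoeff D k (fun κ => c fun v => κ (e v)) =
        fun κ => gmppCoeff C k c fun v => κ (e v) := by
      funext κ
      simp only [gmppCoeff, gmppSum_transport e h]
      congr 1
      exact Equiv.sum_comp (Equiv.arrowCongr e.symm (Equiv.refl _)) (gmppSum C k c)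
    rw [coeffRun, List.foldl_cons, this]
    exact ih _

lemma gmppPurifies_transport {G : SimpleGraph V} {H : SimpleGraph W} (C : G.Coloring Bool)
    (D : H.Coloring Bool) (e : V ≃ W) (h : ∀ v, D (e v) = C v) (c : Bits V → ℝ) :
    GMPPPurifies C (graphDiagonal G c) ↔
      GMPPPurifies D (graphDiagonal H fun κ => c fun v => κ (e v)) := by
  simp only [gmppPurifies_graphDiagonal, coeffRun_transport e h]
  rfl

end Transport

/-! ### Postponing the normalization. -/

section Homogeneity

variable {V : Type*} [Fintype V]

lemma gmppSum_smul (C : V → Bool) (k : Bool) (t : ℝ) (c : Bits V → ℝ) :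
    gmppSum C k (fun μ => t * c μ) = fun μ => t ^ 2 * gmppSum C k c μ := by
  funext μ
  simp only [gmppSum, Finset.mul_sum]
  exact Finset.sum_congr rfl fun ν _ => by ring

lemma gmppCoeff_smul (C : V → Bool) (k : Bool) {t : ℝ} (ht : t ≠ 0) (c : Bits V → ℝ) :
    gmppCoeff C k (fun μ => t * c μ) = gmppCoeff C k c := by
  funext μ
  simp only [gmppCoeff, gmppSum_smul, ← Finset.mul_sum]
  exact mul_div_mul_left _ _ (pow_ne_zero 2 ht)

lemma gmppSum_nonneg (C : V → Bool) (k : Bool) {c : Bits V → ℝ} (hc : ∀ μ, 0 ≤ c μ) (μ : Bits V) :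
    0 ≤ gmppSum C k c μ :=
  Finset.sum_nonneg fun _ _ => mul_nonneg (hc _) (hc _)

lemma sum_gmppSum_pos (C : V → Bool) (k : Bool) {c : Bits V → ℝ} (hc : ∀ μ, 0 ≤ c μ)
    (hs : 0 < ∑ μ, c μ) : 0 < ∑ μ, gmppSum C k c μ := by
  obtain ⟨μ, -, hμ⟩ := Finset.exists_lt_of_sum_lt (s := Finset.univ) (f := fun _ : Bits V => (0 : ℝ))
    (g := c) (by simpa using hs)
  refine Finset.sum_pos' (fun κ _ => gmppSum_nonneg C k hc κ)
    -- At `μ` cut off to colour `k`, the term `ν = μ` of the sum is `c μ * c μ`.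
    ⟨fun v => if C v = k then μ v else 0, Finset.mem_univ _, ?_⟩
  refine Finset.sum_pos' (fun ν _ => mul_nonneg (hc _) (hc _)) ⟨μ, ?_, ?_⟩
  · simp +contextual
  · have : (fun v => if C v = k then (if C v = k then μ v else 0) else
        (if C v = k then μ v else 0) + μ v) = μ := by
      funext v
      by_cases h : C v = k <;> simp [h]
    rw [this]
    exact mul_pos hμ hμ

/-- The unnormalized diagonal elements after a sequence of sub-protocols. -/
def sumRun (C : V → Bool) (w : List Bool) (c : Bits V → ℝ) : Bits V → ℝ :=
  w.foldl (fun d k => gmppSum C k d) c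

/-- The rule is homogeneous of degree 2, so one division at the end replaces the division in every
step. -/
lemma coeffRun_eq_sumRun (C : V → Bool) (w : List Bool) {c : Bits V → ℝ} (hc : ∀ μ, 0 ≤ c μ)
    (hs : 0 < ∑ μ, c μ) :
    coeffRun C w (fun μ => c μ / ∑ κ, c κ) =
      fun μ => sumRun C w c μ / ∑ κ, sumRun C w c κ := by
  induction w generalizing c with
  | nil => rfl
  | cons k w ih =>
    have h := ih (gmppSum_nonneg C k hc) (sum_gmppSum_pos C k hc hs)
    have e : gmppCoeff C k (fun μ => c μ / ∑ κ, c κ) =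
        fun μ => gmppSum C k c μ / ∑ κ, gmppSum C k c κ := by
      simp only [div_eq_inv_mul (c _)]
      rw [gmppCoeff_smul C k (inv_ne_zero hs.ne')]
      rfl
    rw [coeffRun, List.foldl_cons, e]
    exact h

lemma coeffRun_distribution (C : V → Bool) (w : List Bool) {c : Bits V → ℝ}
    (hc : IsDistribution c) :
    coeffRun C w c = fun μ => sumRun C w c μ / ∑ κ, sumRun C w c κ := by
  have h := coeffRun_eq_sumRun C w hc.1 (by rw [hc.2]; exact one_pos)
  simpa only [hc.2, div_one] using h

lemma gmppPurifies_iff_sumRun {G : SimpleGraph V} (C : G.Coloring Bool) {c : Bits V → ℝ}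
    (hc : IsDistribution c) :
    GMPPPurifies C (graphDiagonal G c) ↔ ∀ ε : ℝ, 0 < ε → ∃ w : List Bool,
      1 - ε < sumRun C w c 0 / ∑ κ, sumRun C w c κ := by
  simp only [gmppPurifies_graphDiagonal, coeffRun_distribution C _ hc]

end Homogeneity

/-! ### Independent errors. -/

section Noise

variable {V : Type*} [Fintype V]

lemma sum_bits_prod {M : Type*} [CommSemiring M] {inst : Fintype (Bits V)} (f : V → ZMod 2 → M) :
    ∑ x : Bits V, ∏ v, f v (x v) = ∏ v, (f v 0 + f v 1) := by
  rw [Subsingleton.elim inst Pi.instFintype]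
  have h := (Finset.prod_univ_sum (fun _ : V => (Finset.univ : Finset (ZMod 2))) f).symm
  rw [Fintype.piFinset_univ] at h
  rw [h]
  exact Finset.prod_congr rfl fun v _ => sum_zmod_two _

lemma isDistribution_zNoise {q : V → ℝ} (h0 : ∀ v, 0 ≤ q v) (h1 : ∀ v, q v ≤ 1) :
    IsDistribution (zNoise q) := by
  constructor
  · intro μ
    refine Finset.prod_nonneg fun v _ => ?_
    split_ifs
    · linarith [h1 v]
    · exact h0 v
  · unfold zNoise
    rw [sum_bits_prod fun v a => if a = 0 then 1 - q v else q v]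
    simp

end Noise

/-! ### Reduction of the chain to 2×2 tables. -/

section Chain

lemma one_add_one_zmod_two : (1 : ZMod 2) + 1 = 0 := by decide

lemma sum_fin_succ {α M : Type*} [Fintype α] [AddCommMonoid M] {n : ℕ} (F : (Fin (n + 1) → α) → M) :
    ∑ x, F x = ∑ a, ∑ y : Fin n → α, F (Matrix.vecCons a y) := by
  rw [← Equiv.sum_comp (Fin.consEquiv fun _ => α), Fintype.sum_prod_type]
  rfl

lemma sum_fin_four {α M : Type*} [Fintype α] [AddCommMonoid M] {inst : Fintype (Fin 4 → α)}
    (F : (Fin 4 → α) → M) : ∑ x, F x = ∑ a, ∑ b, ∑ c, ∑ d, F ![a, b, c, d] := by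
  rw [Subsingleton.elim inst Pi.instFintype]
  simp only [sum_fin_succ, Finset.univ_unique, Finset.sum_singleton]
  rfl

/-- Diagonal elements of a four-qubit state without errors on the inner qubits. -/
def chainTable (f : ZMod 2 → ZMod 2 → ℝ) : Bits (Fin 4) → ℝ := fun μ =>
  if μ 1 = 0 ∧ μ 2 = 0 then f (μ 0) (μ 3) else 0

/-- The rule for the diagonal elements with respect to the second index. -/
def convRight (f : ZMod 2 → ZMod 2 → ℝ) : ZMod 2 → ZMod 2 → ℝ := fun i j =>
  ∑ j', f i j' * f i (j + j')

/-- The rule for the diagonal elements with respect to the first index. -/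
def convLeft (f : ZMod 2 → ZMod 2 → ℝ) : ZMod 2 → ZMod 2 → ℝ := fun i j =>
  ∑ i', f i' j * f (i + i') j

/-- The sum of the four entries. -/
def total (f : ZMod 2 → ZMod 2 → ℝ) : ℝ := f 0 0 + f 0 1 + (f 1 0 + f 1 1)

lemma sum_chainTable {inst : Fintype (Bits (Fin 4))} (f : ZMod 2 → ZMod 2 → ℝ) :
    ∑ μ, chainTable f μ = total f := by
  simp [sum_fin_four, chainTable, sum_zmod_two, total]

lemma convRight_zero (f : ZMod 2 → ZMod 2 → ℝ) (i : ZMod 2) :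
    convRight f i 0 = f i 0 ^ 2 + f i 1 ^ 2 := by
  simp [convRight, sum_zmod_two, sq]

lemma convRight_one (f : ZMod 2 → ZMod 2 → ℝ) (i : ZMod 2) :
    convRight f i 1 = 2 * f i 0 * f i 1 := by
  simp [convRight, sum_zmod_two, one_add_one_zmod_two]; ring

lemma convLeft_zero (f : ZMod 2 → ZMod 2 → ℝ) (j : ZMod 2) :
    convLeft f 0 j = f 0 j ^ 2 + f 1 j ^ 2 := by
  simp [convLeft, sum_zmod_two, sq]

lemma convLeft_one (f : ZMod 2 → ZMod 2 → ℝ) (j : ZMod 2) :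
    convLeft f 1 j = 2 * f 0 j * f 1 j := by
  simp [convLeft, sum_zmod_two, one_add_one_zmod_two]; ring

lemma chain_coloring (C : chain.Coloring Bool) : C 1 = !C 0 ∧ C 2 = C 0 ∧ C 3 = !C 0 := by
  have h01 : C 0 ≠ C 1 := C.valid (by simp [SimpleGraph.pathGraph_adj])
  have h12 : C 1 ≠ C 2 := C.valid (by simp [SimpleGraph.pathGraph_adj])
  have h23 : C 2 ≠ C 3 := C.valid (by simp [SimpleGraph.pathGraph_adj])
  revert h01 h12 h23
  generalize C 0 = a; generalize C 1 = b; generalize C 2 = c; generalize C 3 = d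
  revert a b c d; decide

/-- Vertices 1 and 3 have the other colour and only 3 carries errors, so the convolution runs over
the second index alone. -/
lemma gmppSum_chainTable_same (C : chain.Coloring Bool) (f : ZMod 2 → ZMod 2 → ℝ) :
    gmppSum C (C 0) (chainTable f) = chainTable (convRight f) := by
  obtain ⟨h1, h2, h3⟩ := chain_coloring C
  funext μ
  simp only [gmppSum, Finset.sum_filter, sum_fin_four, Fin.forall_fin_succ, sum_zmod_two,
    chainTable, convRight]
  rcases zmod_two_cases (μ 0) with m0 | m0 <;> rcases zmod_two_cases (μ 1) with m1 | m1 <;>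
    rcases zmod_two_cases (μ 2) with m2 | m2 <;> rcases zmod_two_cases (μ 3) with m3 | m3 <;>
    simp [m0, m1, m2, m3, h1, h2, h3, one_add_one_zmod_two]

lemma gmppSum_chainTable_other (C : chain.Coloring Bool) (f : ZMod 2 → ZMod 2 → ℝ) :
    gmppSum C (!C 0) (chainTable f) = chainTable (convLeft f) := by
  obtain ⟨h1, h2, h3⟩ := chain_coloring C
  funext μ
  simp only [gmppSum, Finset.sum_filter, sum_fin_four, Fin.forall_fin_succ, sum_zmod_two,
    chainTable, convLeft]
  rcases zmod_two_cases (μ 0) with m0 | m0 <;> rcases zmod_two_cases (μ 1) with m1 | m1 <;>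
    rcases zmod_two_cases (μ 2) with m2 | m2 <;> rcases zmod_two_cases (μ 3) with m3 | m3 <;>
    simp [m0, m1, m2, m3, h1, h2, h3, one_add_one_zmod_two]

end Chain

/-! ### Dynamics of the 2×2 tables. -/

section Recurrence

variable {f : ZMod 2 → ZMod 2 → ℝ}

lemma convRight_nonneg (hf : ∀ i j, 0 ≤ f i j) (i j : ZMod 2) : 0 ≤ convRight f i j :=
  Finset.sum_nonneg fun _ _ => mul_nonneg (hf _ _) (hf _ _)

lemma convLeft_nonneg (hf : ∀ i j, 0 ≤ f i j) (i j : ZMod 2) : 0 ≤ convLeft f i j :=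
  Finset.sum_nonneg fun _ _ => mul_nonneg (hf _ _) (hf _ _)

/-- Sum and difference of a row diagonalize the convolution on two points: each step squares both.
-/
lemma iterate_convRight (f : ZMod 2 → ZMod 2 → ℝ) (n : ℕ) (i : ZMod 2) :
    convRight^[n] f i 0 + convRight^[n] f i 1 = (f i 0 + f i 1) ^ 2 ^ n ∧
      convRight^[n] f i 0 - convRight^[n] f i 1 = (f i 0 - f i 1) ^ 2 ^ n := by
  induction n with
  | zero => simp
  | succ n ih =>
    rw [Function.iterate_succ_apply', convRight_zero, convRight_one, pow_succ 2 n, pow_mul,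
      pow_mul, ← ih.1, ← ih.2]
    constructor <;> ring

lemma iterate_convLeft (f : ZMod 2 → ZMod 2 → ℝ) (n : ℕ) (j : ZMod 2) :
    convLeft^[n] f 0 j + convLeft^[n] f 1 j = (f 0 j + f 1 j) ^ 2 ^ n ∧
      convLeft^[n] f 0 j - convLeft^[n] f 1 j = (f 0 j - f 1 j) ^ 2 ^ n := by
  induction n with
  | zero => simp
  | succ n ih =>
    rw [Function.iterate_succ_apply', convLeft_zero, convLeft_one, pow_succ 2 n, pow_mul,
      pow_mul, ← ih.1, ← ih.2]
    constructor <;> ring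

lemma iterate_convRight_nonneg (hf : ∀ i j, 0 ≤ f i j) (n : ℕ) (i j : ZMod 2) :
    0 ≤ convRight^[n] f i j := by
  induction n generalizing i j with
  | zero => exact hf i j
  | succ n ih =>
    rw [Function.iterate_succ_apply']
    exact convRight_nonneg ih i j

/-- Two well separated decay rates can be resolved by a suitable choice of exponents. -/
lemma exists_exponents {x y : ℝ} (hx : 0 ≤ x) (hxy : x < y) (hy : y ≤ 1) {ε : ℝ} (hε : 0 < ε) :
    ∃ n m : ℕ, 2 * 2 ^ m * x ^ 2 ^ n + Real.exp (-(2 ^ m * (y ^ 2 ^ n - x ^ 2 ^ n))) < ε := by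
  have hy0 : 0 < y := hx.trans_lt hxy
  -- `K` is the target size of `2^m y^(2^n)`; the 1 in `K - 1` leaves room for the term `2^m
  -- x^(2^n)`.
  obtain ⟨K, hK1, hK⟩ : ∃ K : ℝ, 1 ≤ K ∧ Real.exp (-(K - 1)) < ε / 2 := by
    have h : Filter.Tendsto (fun K : ℝ => Real.exp (-(K - 1))) Filter.atTop (nhds 0) :=
      Real.tendsto_exp_neg_atTop_nhds_zero.comp
        (Filter.tendsto_atTop_add_const_right _ (-1) Filter.tendsto_id)
    obtain ⟨K, h1, h2⟩ := ((h.eventually (gt_mem_nhds (half_pos hε))).and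
      (Filter.eventually_ge_atTop 1)).exists
    exact ⟨K, h2, h1⟩
  have hK0 : 0 < K := one_pos.trans_le hK1
  obtain ⟨n, hn⟩ : ∃ n : ℕ, (x / y) ^ 2 ^ n < min (ε / (8 * K)) (1 / (2 * K)) := by
    have h := (tendsto_pow_atTop_nhds_zero_of_lt_one (div_nonneg hx hy0.le)
      ((div_lt_one hy0).2 hxy)).comp (tendsto_pow_atTop_atTop_of_one_lt (r := 2) one_lt_two)
    exact (h.eventually (gt_mem_nhds (by positivity))).exists
  have hyn : 0 < y ^ 2 ^ n := pow_pos hy0 _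
  -- With `m + 1` as the exponent, `K < 2^(m+1) y^(2^n) ≤ 2K`.
  obtain ⟨m, hm1, hm2⟩ := exists_nat_pow_near
    ((one_le_div hyn).2 ((pow_le_one₀ hy0.le hy).trans hK1)) (one_lt_two (α := ℝ))
  rw [le_div_iff₀ hyn] at hm1
  rw [div_lt_iff₀ hyn] at hm2
  have hxn : x ^ 2 ^ n = (x / y) ^ 2 ^ n * y ^ 2 ^ n := by
    rw [← mul_pow, div_mul_cancel₀ _ hy0.ne']
  have hr0 : 0 ≤ (x / y) ^ 2 ^ n := pow_nonneg (div_nonneg hx hy0.le) _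
  have h1 : (2 : ℝ) ^ (m + 1) * x ^ 2 ^ n ≤ 2 * K * (x / y) ^ 2 ^ n := by
    rw [hxn, pow_succ]
    nlinarith
  have hn1 := (lt_min_iff.1 hn).1
  have hn2 := (lt_min_iff.1 hn).2
  rw [lt_div_iff₀ (by positivity)] at hn1 hn2
  refine ⟨n, m + 1, ?_⟩
  have h2 : Real.exp (-(2 ^ (m + 1) * (y ^ 2 ^ n - x ^ 2 ^ n))) ≤ Real.exp (-(K - 1)) := by
    refine Real.exp_le_exp.2 ?_
    rw [mul_sub]
    linarith
  linarith

/-- If the first diagonal element exceeds the sum of the others, then a number of steps of the first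
kind followed by a number of steps of the second kind purifies. -/
lemma exists_iterate_total (hf : ∀ i j, 0 ≤ f i j) (h : f 0 1 + (f 1 0 + f 1 1) < f 0 0) {ε : ℝ}
    (hε : 0 < ε) :
    ∃ n m : ℕ, 1 - ε < convLeft^[m] (convRight^[n] f) 0 0 /
      total (convLeft^[m] (convRight^[n] f)) := by
  have hs : 0 < f 0 0 + f 0 1 := by linarith [hf 0 1, hf 1 0, hf 1 1]
  -- `x` is the weight of row 1 and `y` the bias of row 0, both relative to the weight of row 0; `x
  -- < y` is the hypothesis `h`.
  obtain ⟨n, m, hnm⟩ := exists_exponents (x := (f 1 0 + f 1 1) / (f 0 0 + f 0 1))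
    (y := (f 0 0 - f 0 1) / (f 0 0 + f 0 1)) (div_nonneg (add_nonneg (hf _ _) (hf _ _)) hs.le)
    (div_lt_div_of_pos_right (by linarith) hs)
    ((div_le_one hs).2 (by linarith [hf 0 1])) hε
  refine ⟨n, m, ?_⟩
  set g := convRight^[n] f with hg
  have hg0 : ∀ i j, 0 ≤ g i j := iterate_convRight_nonneg hf n
  obtain ⟨hs1, hr1⟩ := iterate_convRight f n 0
  have ht1 := (iterate_convRight f n 1).1
  rw [← hg] at hs1 hr1 ht1
  obtain ⟨hu, hv⟩ := iterate_convLeft g m 0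
  have hz := (iterate_convLeft g m 1).1
  set H := convLeft^[m] g with hH
  rw [div_pow, div_pow, ← hs1, ← hr1, ← ht1] at hnm
  have hS : 0 < g 0 0 + g 0 1 := hs1 ▸ pow_pos hs _
  have hR : 0 ≤ g 0 0 - g 0 1 := hr1 ▸ pow_nonneg (by linarith [hf 1 0, hf 1 1]) _
  have hRT : g 1 0 + g 1 1 ≤ g 0 0 - g 0 1 := by
    rw [hr1, ht1]
    exact pow_le_pow_left₀ (add_nonneg (hf _ _) (hf _ _)) (by linarith) _
  have ha : 0 < g 0 0 := by linarith [hg0 0 1]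
  have hac : 0 < g 0 0 + g 1 0 := by linarith [hg0 1 0]
  have hT : total H = (g 0 0 + g 1 0) ^ 2 ^ m + (g 0 1 + g 1 1) ^ 2 ^ m := by
    rw [← hu, ← hz, total]; ring
  have hP : 0 < (g 0 0 + g 1 0) ^ 2 ^ m := pow_pos hac _
  have hQ : 0 ≤ (g 0 1 + g 1 1) ^ 2 ^ m := pow_nonneg (add_nonneg (hg0 _ _) (hg0 _ _)) _
  have hTpos : 0 < total H := by rw [hT]; linarith
  -- the part of the error that is suppressed by the first kind of steps
  have hM : ((2 ^ m : ℕ) : ℝ) = 2 ^ m := by push_cast; rfl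
  have b1 : 1 - 2 ^ m * (4 * ((g 1 0 + g 1 1) / (g 0 0 + g 0 1))) ≤
      (g 0 0 - g 1 0) ^ 2 ^ m / (g 0 0 + g 1 0) ^ 2 ^ m := by
    have e : (g 0 0 - g 1 0) / (g 0 0 + g 1 0) = 1 + -(2 * g 1 0 / (g 0 0 + g 1 0)) := by
      field_simp; ring
    have l1 : 2 * g 1 0 / (g 0 0 + g 1 0) ≤ 2 := by
      -- Bernoulli's inequality below needs a base increment of at least -2.
      rw [div_le_iff₀ hac]; linarith
    -- The bias is nonnegative, so `g 0 0` is at least half of row 0; this doubles the constant 2 to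
    -- 4.
    have l2 : 2 * g 1 0 / (g 0 0 + g 1 0) ≤ 4 * ((g 1 0 + g 1 1) / (g 0 0 + g 0 1)) := by
      rw [← mul_div_assoc, div_le_div_iff₀ hac hS]
      nlinarith [hg0 1 0, hg0 1 1, mul_nonneg (hg0 1 0) hR, mul_nonneg (hg0 1 1) hac.le,
        mul_nonneg (hg0 1 0) (hg0 1 0)]
    have l3 := one_add_mul_le_pow (a := -(2 * g 1 0 / (g 0 0 + g 1 0))) (by linarith) (2 ^ m)
    rw [← div_pow, e]
    rw [hM] at l3
    have l4 := mul_le_mul_of_nonneg_left l2 (pow_nonneg (zero_le_two (α := ℝ)) m)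
    linarith
  -- the part of the error that is suppressed by the second kind of steps
  have b2 : (g 0 1 + g 1 1) ^ 2 ^ m / (g 0 0 + g 1 0) ^ 2 ^ m ≤
      Real.exp (-(2 ^ m * ((g 0 0 - g 0 1) / (g 0 0 + g 0 1) -
        (g 1 0 + g 1 1) / (g 0 0 + g 0 1)))) := by
    have l1 : (g 0 1 + g 1 1) / (g 0 0 + g 1 0) ≤
        Real.exp (-((g 0 0 - g 0 1) / (g 0 0 + g 0 1) - (g 1 0 + g 1 1) / (g 0 0 + g 0 1))) := by
      refine le_trans ?_ (Real.add_one_le_exp _)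
      rw [← sub_div, ← neg_div, div_add_one hS.ne', div_le_div_iff₀ hac hS]
      nlinarith [mul_nonneg (hg0 0 1) (sub_nonneg.2 hRT), mul_nonneg (hg0 0 1) (hg0 1 0),
        mul_nonneg (hg0 1 0) (hg0 1 1), mul_nonneg ha.le (hg0 1 0),
        mul_nonneg (hg0 1 0) (hg0 1 0)]
    have l2 := pow_le_pow_left₀ (div_nonneg (add_nonneg (hg0 0 1) (hg0 1 1)) hac.le) l1 (2 ^ m)
    rw [← div_pow]
    refine l2.trans (le_of_eq ?_)
    rw [← Real.exp_nat_mul, hM]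
    congr 1; ring
  rw [lt_div_iff₀ hTpos, hT]
  rw [le_div_iff₀ hP] at b1
  rw [div_le_iff₀ hP] at b2
  have h00 : H 0 0 = ((g 0 0 + g 1 0) ^ 2 ^ m + (g 0 0 - g 1 0) ^ 2 ^ m) / 2 := by
    rw [← hu, ← hv]; ring
  rw [h00]
  have h3 := mul_lt_mul_of_pos_right hnm hP
  nlinarith

/-- No diagonal element exceeds the sum of the others. -/
def Balanced (f : ZMod 2 → ZMod 2 → ℝ) : Prop :=
  (∀ i j, 0 ≤ f i j) ∧ ∀ i j, 2 * f i j ≤ total f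

/-- For an entry with second index 0 the claim reads `(f i 0 - f i 1)^2 ≤ (sum of the other row)^2`,
which the bounds on `f i 0` and `f i 1` give together. For second index 1 it holds by the
arithmetic-geometric mean inequality. -/
lemma Balanced.convRight (h : Balanced f) : Balanced (convRight f) := by
  refine ⟨convRight_nonneg h.1, fun i j => ?_⟩
  have e00 := h.1 0 0; have e01 := h.1 0 1; have e10 := h.1 1 0; have e11 := h.1 1 1
  have l00 := h.2 0 0; have l01 := h.2 0 1; have l10 := h.2 1 0; have l11 := h.2 1 1
  simp only [total, convRight_zero, convRight_one] at *
  rcases zmod_two_cases i with rfl | rfl <;> rcases zmod_two_cases j with rfl | rfl <;>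
    simp only [convRight_zero, convRight_one]
  · nlinarith [mul_nonneg (sub_nonneg.2 l00) (sub_nonneg.2 l01)]
  · nlinarith [sq_nonneg (f 0 0 - f 0 1), sq_nonneg (f 1 0 + f 1 1)]
  · nlinarith [mul_nonneg (sub_nonneg.2 l10) (sub_nonneg.2 l11)]
  · nlinarith [sq_nonneg (f 1 0 - f 1 1), sq_nonneg (f 0 0 + f 0 1)]

lemma Balanced.convLeft (h : Balanced f) : Balanced (convLeft f) := by
  refine ⟨convLeft_nonneg h.1, fun i j => ?_⟩
  have l00 := h.2 0 0; have l01 := h.2 0 1; have l10 := h.2 1 0; have l11 := h.2 1 1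
  simp only [total, convLeft_zero, convLeft_one] at *
  rcases zmod_two_cases i with rfl | rfl <;> rcases zmod_two_cases j with rfl | rfl <;>
    simp only [convLeft_zero, convLeft_one]
  · nlinarith [mul_nonneg (sub_nonneg.2 l00) (sub_nonneg.2 l10)]
  · nlinarith [mul_nonneg (sub_nonneg.2 l01) (sub_nonneg.2 l11)]
  · nlinarith [sq_nonneg (f 0 0 - f 1 0), sq_nonneg (f 0 1 + f 1 1)]
  · nlinarith [sq_nonneg (f 0 1 - f 1 1), sq_nonneg (f 0 0 + f 1 0)]

end Recurrence

/-! ### The threshold of the GMPP on the noisy chain. -/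

section NoisyChain

lemma sumRun_append (C : Fin 4 → Bool) (w w' : List Bool) (c : Bits (Fin 4) → ℝ) :
    sumRun C (w ++ w') c = sumRun C w' (sumRun C w c) :=
  List.foldl_append ..

lemma sumRun_replicate_same (C : chain.Coloring Bool) (n : ℕ) (f : ZMod 2 → ZMod 2 → ℝ) :
    sumRun C (List.replicate n (C 0)) (chainTable f) = chainTable (convRight^[n] f) := by
  induction n generalizing f with
  | zero => rfl
  | succ n ih =>
    rw [List.replicate_succ, sumRun, List.foldl_cons, gmppSum_chainTable_same]
    exact ih _

lemma sumRun_replicate_other (C : chain.Coloring Bool) (n : ℕ) (f : ZMod 2 → ZMod 2 → ℝ) :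
    sumRun C (List.replicate n (!C 0)) (chainTable f) = chainTable (convLeft^[n] f) := by
  induction n generalizing f with
  | zero => rfl
  | succ n ih =>
    rw [List.replicate_succ, sumRun, List.foldl_cons, gmppSum_chainTable_other]
    exact ih _

lemma sumRun_balanced (C : chain.Coloring Bool) (w : List Bool) {f : ZMod 2 → ZMod 2 → ℝ}
    (hf : Balanced f) : ∃ g, Balanced g ∧ sumRun C w (chainTable f) = chainTable g := by
  induction w generalizing f with
  | nil => exact ⟨f, hf, rfl⟩
  | cons k w ih =>
    rw [sumRun, List.foldl_cons]
    by_cases hk : k = C 0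
    · rw [hk, gmppSum_chainTable_same]
      exact ih hf.convRight
    · rw [Bool.eq_not_of_ne hk, gmppSum_chainTable_other]
      exact ih hf.convLeft

lemma chainTable_zero (f : ZMod 2 → ZMod 2 → ℝ) : chainTable f 0 = f 0 0 := by
  simp [chainTable]

/-- The diagonal elements of the noisy chain. -/
def noiseTable (p : ℝ) : ZMod 2 → ZMod 2 → ℝ := fun i j =>
  (if i = 0 then 1 - p else p) * (if j = 0 then 1 - p else p)

lemma zNoise_chain (p : ℝ) :
    zNoise (fun v : Fin 4 => if v = 0 ∨ v = 3 then p else 0) = chainTable (noiseTable p) := by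
  funext μ
  rw [zNoise, Fin.prod_univ_four, chainTable, noiseTable]
  rcases zmod_two_cases (μ 1) with m1 | m1 <;> rcases zmod_two_cases (μ 2) with m2 | m2 <;>
    simp [m1, m2]

lemma isDistribution_noiseTable {p : ℝ} (h0 : 0 ≤ p) (h1 : p ≤ 1) :
    IsDistribution (chainTable (noiseTable p)) := by
  rw [← zNoise_chain]
  refine isDistribution_zNoise (fun v => ?_) (fun v => ?_)
  · split_ifs <;> simp [h0]
  · split_ifs <;> simp [h1]

lemma noiseTable_nonneg {p : ℝ} (h0 : 0 ≤ p) (h1 : p ≤ 1) (i j : ZMod 2) :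
    0 ≤ noiseTable p i j := by
  unfold noiseTable
  have : 0 ≤ 1 - p := by linarith
  split_ifs <;> positivity

lemma total_noiseTable (p : ℝ) : total (noiseTable p) = 1 := by
  simp [total, noiseTable]; ring

lemma noisyChain_eq (p : ℝ) :
    noisyChain p = graphDiagonal chain (chainTable (noiseTable p)) := by
  rw [noisyChain, zNoise_chain]

lemma fidelity_noisyChain (p : ℝ) :
    fidelity (graphState chain) (noisyChain p) = (1 - p) ^ 2 := by
  rw [noisyChain_eq, fidelity_graphDiagonal, chainTable_zero]
  simp [noiseTable, sq]

lemma exists_sumRun {inst : Fintype (Bits (Fin 4))} (C : chain.Coloring Bool)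
    {f : ZMod 2 → ZMod 2 → ℝ} (hf : ∀ i j, 0 ≤ f i j) (h : f 0 1 + (f 1 0 + f 1 1) < f 0 0) {ε : ℝ} (hε : 0 < ε) :
    ∃ w : List Bool, 1 - ε < sumRun C w (chainTable f) 0 / ∑ κ, sumRun C w (chainTable f) κ := by
  obtain ⟨n, m, hnm⟩ := exists_iterate_total hf h hε
  refine ⟨List.replicate n (C 0) ++ List.replicate m (!C 0), ?_⟩
  rwa [sumRun_append, sumRun_replicate_same, sumRun_replicate_other, sum_chainTable,
    chainTable_zero]

lemma gmppPurifies_noisyChain (C : chain.Coloring Bool) {p : ℝ} (h0 : 0 ≤ p) (h1 : p ≤ 1) :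
    GMPPPurifies C (noisyChain p) ↔ p < 1 - 1 / √2 ∨ 1 / √2 < p := by
  have hr : (1 / √2) ^ 2 = (1 / 2 : ℝ) := by rw [div_pow, Real.sq_sqrt (by norm_num), one_pow]
  have hr0 : 0 < 1 / √2 := by positivity
  set r := 1 / √2 with hrdef
  rw [noisyChain_eq, gmppPurifies_iff_sumRun C (isDistribution_noiseTable h0 h1)]
  have hT := total_noiseTable p
  have hN := noiseTable_nonneg h0 h1
  have v00 : noiseTable p 0 0 = (1 - p) ^ 2 := by simp [noiseTable, sq]
  have v01 : noiseTable p 0 1 = (1 - p) * p := by simp [noiseTable]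
  have v10 : noiseTable p 1 0 = (1 - p) * p := by simp [noiseTable, mul_comm]
  have v11 : noiseTable p 1 1 = p ^ 2 := by simp [noiseTable, sq]
  constructor
  · intro h
    by_contra! hp
    have hb : Balanced (noiseTable p) := by
      refine ⟨hN, fun i j => ?_⟩
      rw [hT]
      rcases zmod_two_cases i with rfl | rfl <;> rcases zmod_two_cases j with rfl | rfl
      · rw [v00]; nlinarith
      · rw [v01]; nlinarith [sq_nonneg (1 - 2 * p)]
      · rw [v10]; nlinarith [sq_nonneg (1 - 2 * p)]
      · rw [v11]; nlinarith
    -- Balance bounds every reachable fidelity by 1/2.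
    obtain ⟨w, hw⟩ := h (1 / 2) (by norm_num)
    obtain ⟨g, hg, e⟩ := sumRun_balanced C w hb
    rw [e, chainTable_zero, sum_chainTable] at hw
    have hg0 := hg.2 0 0
    have : g 0 0 / total g ≤ 1 / 2 := by
      refine div_le_of_le_mul₀ ?_ (by norm_num) (by linarith)
      linarith [hg.1 0 0]
    linarith
  · rintro (hp | hp) ε hε
    · refine exists_sumRun C hN ?_ hε
      rw [v00, v01, v10, v11]
      nlinarith
    -- The dominant entry is now 11: one step along each index moves it to 10 and then to 00, still
    -- above the sum of the others.
    · have hR := convRight_nonneg hN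
      obtain ⟨w, hw⟩ := exists_sumRun C (convLeft_nonneg hR)
        (by
          have k1 : noiseTable p 0 0 + noiseTable p 0 1 + noiseTable p 1 0 < noiseTable p 1 1 := by
            rw [v00, v01, v10, v11]; nlinarith
          have n00 := hN 0 0
          have n01 := hN 0 1
          have n10 := hN 1 0
          have k2 : convRight (noiseTable p) 0 0 + convRight (noiseTable p) 0 1 +
              convRight (noiseTable p) 1 1 < convRight (noiseTable p) 1 0 := by
            simp only [convRight_zero, convRight_one]
            nlinarith
          have r00 := hR 0 0
          have r01 := hR 0 1
          have r11 := hR 1 1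
          simp only [convLeft_zero, convLeft_one]
          nlinarith) hε
      refine ⟨C 0 :: (!C 0) :: w, ?_⟩
      rw [sumRun, List.foldl_cons, List.foldl_cons, gmppSum_chainTable_same,
        gmppSum_chainTable_other]
      exact hw

end NoisyChain

/-! ### Measuring out qubits and passing to marginals. -/

section Measurement

variable {V : Type*} [Fintype V] {G : SimpleGraph V}

lemma card_bits {inst : Fintype (Bits V)} : Fintype.card (Bits V) = 2 ^ Fintype.card V := by
  rw [Subsingleton.elim inst Pi.instFintype, Fintype.card_fun, ZMod.card]

/-- Polarization; the two mixed sums, one for each colour of the first vertex, combine into one sum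
over all adjacent pairs. -/
lemma quadForm_add (C : G.Coloring Bool) (k : Bool) (x y : Bits V) :
    quadForm C k (x + y) = quadForm C k x + quadForm C k y +
      ∑ v, ∑ w, if G.Adj v w then x v * y w else 0 := by
  have h : ∑ v, ∑ w, (if G.Adj v w then x v * y w else 0) =
      (∑ v, ∑ w, if C v = k ∧ G.Adj v w then x v * y w else 0) +
        ∑ v, ∑ w, if C v = k ∧ G.Adj v w then y v * x w else 0 := by
    rw [Finset.sum_comm (f := fun v w => if C v = k ∧ G.Adj v w then y v * x w else 0)]
    simp only [← Finset.sum_add_distrib]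
    refine Finset.sum_congr rfl fun v _ => Finset.sum_congr rfl fun w _ => ?_
    by_cases ha : G.Adj v w
    · have hc := C.valid ha
      by_cases hv : C v = k
      · have hw : ¬ C w = k := fun e => hc (hv.trans e.symm)
        simp [ha, hv, hw]
      · have hw : C w = k := by
          revert hv hc
          generalize C v = a; generalize C w = b
          revert a b k; decide
        simp [ha, ha.symm, hv, hw, mul_comm]
    · have ha' : ¬ G.Adj w v := fun e => ha e.symm
      simp [ha, ha']
  rw [h]
  simp only [quadForm, ← Finset.sum_add_distrib]
  refine Finset.sum_congr rfl fun v _ => Finset.sum_congr rfl fun w _ => ?_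
  split_ifs
  · simp only [Pi.add_apply]; ring
  · simp

lemma phase_add (C : G.Coloring Bool) (x y : Bits V) :
    phase G (x + y) = phase G x * phase G y *
      sgn (∑ v, ∑ w, if G.Adj v w then x v * y w else 0) := by
  rw [phase_eq_sgn C true, phase_eq_sgn C true, phase_eq_sgn C true, quadForm_add, sgn_add,
    sgn_add]

lemma sum_set_add_sum_compl {M : Type*} [AddCommMonoid M] (S : Set V) [Fintype S]
    [Fintype (Sᶜ : Set V)] (F : V → M) :
    ∑ v, F v = ∑ v : S, F v + ∑ v : (Sᶜ : Set V), F v := by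
  rw [← Fintype.sum_subtype_add_sum_subtype (· ∈ S) F]
  congr!

lemma prod_set_mul_prod_compl {M : Type*} [CommMonoid M] (S : Set V) [Fintype S]
    [Fintype (Sᶜ : Set V)] (F : V → M) :
    ∏ v, F v = (∏ v : S, F v) * ∏ v : (Sᶜ : Set V), F v := by
  rw [← Fintype.prod_subtype_mul_prod_subtype (· ∈ S) F]
  congr!

lemma glue_mem {V : Type*} {S : Set V} (x : Bits S) (z : Bits (Sᶜ : Set V)) (v : S) :
    glue S x z v = x v := by
  simp [glue]

lemma glue_compl {V : Type*} {S : Set V} (x : Bits S) (z : Bits (Sᶜ : Set V))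
    (v : (Sᶜ : Set V)) : glue S x z v = z v := by
  have h : (v : V) ∉ S := v.2
  simp [glue, h]

lemma glue_add {V : Type*} (S : Set V) (x x' : Bits S) (z z' : Bits (Sᶜ : Set V)) :
    glue S x z + glue S x' z' = glue S (x + x') (z + z') := by
  funext v
  by_cases h : v ∈ S <;> simp [glue, h]

lemma sum_glue {M : Type*} [AddCommMonoid M] (S : Set V) {i : Fintype (Bits S)}
    {j : Fintype (Bits (Sᶜ : Set V))} (F : Bits V → M) :
    ∑ x, F x = ∑ x : Bits S, ∑ z : Bits (Sᶜ : Set V), F (glue S x z) := by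
  rw [← Fintype.sum_prod_type' fun x z => F (glue S x z)]
  let E : Bits V ≃ Bits S × Bits (Sᶜ : Set V) :=
    Equiv.piEquivPiSubtypeProd (· ∈ S) fun _ => ZMod 2
  refine Fintype.sum_equiv E F (fun q => F (glue S q.1 q.2)) fun x => congrArg F ?_
  funext v
  by_cases h : v ∈ S <;> simp [glue, h, E, Equiv.piEquivPiSubtypeProd]

lemma chi_glue (S : Set V) (x y : Bits S) (z w : Bits (Sᶜ : Set V)) :
    chi (glue S x z) (glue S y w) = chi x y * chi z w := by
  simp only [chi]
  rw [sum_set_add_sum_compl S, sgn_add]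
  simp only [glue_mem, glue_compl]

/-- The colouring of an induced subgraph. -/
def inducedColoring (C : G.Coloring Bool) (S : Set V) : (G.induce S).Coloring Bool :=
  C.comp (SimpleGraph.Embedding.induce S).toHom

lemma phase_glue_zero (C : G.Coloring Bool) (S : Set V) [inst : Fintype S] (x : Bits S) :
    phase G (glue S x 0) = phase (G.induce S) x := by
  rw [phase_eq_sgn C true, phase_eq_sgn (inducedColoring C S) true]
  congr 1
  unfold quadForm
  rw [sum_set_add_sum_compl S]
  simp only [sum_set_add_sum_compl S (fun w => if _ ∧ G.Adj _ w then _ * glue S x 0 w else 0),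
    glue_mem, glue_compl, Pi.zero_apply, zero_mul, mul_zero, ite_self, Finset.sum_const_zero,
    add_zero]
  rfl

/-- The cross term of the quadratic form is exactly the sign undone by the corrective `Z`-rotations.
-/
lemma phase_glue (C : G.Coloring Bool) (S : Set V) (x : Bits S) (z : Bits (Sᶜ : Set V)) :
    phase G (glue S x z) = phase (G.induce S) x * phase G (glue S 0 z) *
      chi (fun u : S => ∑ w : (Sᶜ : Set V), if G.Adj u w then z w else 0) x := by
  have e : glue S x z = glue S x 0 + glue S 0 z := by rw [glue_add, add_zero, zero_add]
  rw [e, phase_add C, phase_glue_zero C, chi]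
  congr 2
  rw [sum_set_add_sum_compl S]
  simp only [sum_set_add_sum_compl S (fun w => if G.Adj _ w then _ * glue S 0 z w else 0),
    glue_mem, glue_compl, Pi.zero_apply, zero_mul, mul_zero, ite_self, Finset.sum_const_zero,
    add_zero, zero_add]
  refine Finset.sum_congr rfl fun u _ => ?_
  rw [Finset.sum_mul]
  refine Finset.sum_congr rfl fun w _ => ?_
  split_ifs
  · rw [mul_comm]
  · rw [zero_mul]

/-- The marginal of the diagonal elements. -/
def marginal (S : Set V) (c : Bits V → ℝ) : Bits S → ℝ := fun μ =>
  ∑ ν : Bits (Sᶜ : Set V), c (glue S μ ν)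

lemma fourier_marginal (S : Set V) (c : Bits V → ℝ) (x : Bits S) :
    fourier (marginal S c) x = fourier c (glue S x 0) := by
  rw [fourier, fourier, sum_glue S]
  refine Finset.sum_congr rfl fun μ _ => ?_
  rw [marginal, Complex.ofReal_sum, Finset.sum_mul]
  refine Finset.sum_congr rfl fun ν _ => ?_
  rw [chi_glue, chi_zero_right, mul_one]

lemma pauliZ_conj_apply {inst : Fintype (Bits V)} (μ : Bits V) (ρ : Op V) (x y : Bits V) :
    (pauliZ μ * ρ * pauliZ μ) x y = chi μ x * ρ x y * chi μ y := by
  obtain rfl : inst = Pi.instFintype := Subsingleton.elim _ _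
  rw [pauliZ, Matrix.mul_diagonal, Matrix.diagonal_mul]
  rfl

/-- After correction every outcome gives the same matrix, and their number turns `2^(-|V|)` into
`2^(-|S|)`. The measured bits agree in row and column, so the transform is evaluated at strings
vanishing off `S`, where it is that of the marginal. -/
lemma measureOut_graphDiagonal (C : G.Coloring Bool) (S : Set V) (c : Bits V → ℝ) :
    measureOut G S (graphDiagonal G c) = graphDiagonal (G.induce S) (marginal S c) := by
  ext x x'
  rw [measureOut, Matrix.sum_apply, graphDiagonal_apply, fourier_marginal]
  have h : ∀ z : Bits (Sᶜ : Set V),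
      (pauliZ (fun u : S => ∑ w : (Sᶜ : Set V), if G.Adj u w then z w else 0) *
        (graphDiagonal G c).submatrix (fun x => glue S x z) (fun x => glue S x z) *
        pauliZ (fun u : S => ∑ w : (Sᶜ : Set V), if G.Adj u w then z w else 0)) x x' =
      (2 ^ Fintype.card V)⁻¹ * (phase (G.induce S) x * phase (G.induce S) x') *
        fourier c (glue S (x + x') 0) := by
    intro z
    rw [pauliZ_conj_apply, Matrix.submatrix_apply, graphDiagonal_apply, glue_add, bits_add_self,
      phase_glue C S x z, phase_glue C S x' z]
    set a := chi (fun u : S => ∑ w : (Sᶜ : Set V), if G.Adj u w then z w else 0) x with ha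
    set b := chi (fun u : S => ∑ w : (Sᶜ : Set V), if G.Adj u w then z w else 0) x' with hb
    have e1 : a * a = 1 := chi_mul_self _ _
    have e2 : b * b = 1 := chi_mul_self _ _
    have e3 := phase_mul_self G (glue S 0 z)
    linear_combination (2 ^ Fintype.card V)⁻¹ * (phase (G.induce S) x * phase (G.induce S) x') *
        fourier c (glue S (x + x') 0) * (b * b * phase G (glue S 0 z) * phase G (glue S 0 z) * e1 +
          phase G (glue S 0 z) * phase G (glue S 0 z) * e2 + e3)
  have hcard : Fintype.card V = Fintype.card S + Fintype.card (Sᶜ : Set V) := by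
    have h := sum_set_add_sum_compl S fun _ : V => 1
    simpa only [Finset.sum_const, Finset.card_univ, smul_eq_mul, mul_one] using h
  rw [Finset.sum_congr rfl fun z _ => h z, Finset.sum_const, Finset.card_univ, card_bits,
    nsmul_eq_mul, hcard, pow_add, mul_inv]
  have : (2 : ℂ) ^ Fintype.card (Sᶜ : Set V) ≠ 0 := pow_ne_zero _ two_ne_zero
  push_cast
  field_simp

lemma measureOut_graphDiagonal_inst (C : G.Coloring Bool) (S : Set V) {inst : Fintype S}
    (c : Bits V → ℝ) :
    measureOut G S (graphDiagonal G c) = @graphDiagonal S inst (G.induce S) (marginal S c) := by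
  rw [measureOut_graphDiagonal C]
  congr!

lemma pauliZ_conj_graphDiagonal {inst : Fintype (Bits V)} (G : SimpleGraph V) (μ : Bits V)
    (c : Bits V → ℝ) :
    pauliZ μ * graphDiagonal G c * pauliZ μ = graphDiagonal G fun κ => c (κ + μ) := by
  obtain rfl : inst = Pi.instFintype := Subsingleton.elim _ _
  ext x y
  rw [pauliZ_conj_apply, graphDiagonal_apply, graphDiagonal_apply]
  have h : fourier (fun κ => c (κ + μ)) (x + y) = chi μ (x + y) * fourier c (x + y) := by
    rw [fourier, fourier, Finset.mul_sum, ← Equiv.sum_comp (Equiv.addRight μ)]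
    refine Finset.sum_congr rfl fun κ _ => ?_
    simp only [Equiv.coe_addRight, add_assoc, bits_add_self, add_zero]
    rw [chi_add_left]
    ring
  rw [h, chi_add_right]
  ring

lemma marginal_zNoise (S : Set V) [inst : Fintype S] (q : V → ℝ) :
    marginal S (zNoise q) = zNoise fun v : S => q v := by
  funext μ
  simp only [marginal, zNoise]
  simp only [prod_set_mul_prod_compl S (fun v => if glue S μ _ v = 0 then 1 - q v else q v),
    glue_mem, glue_compl]
  rw [← Finset.mul_sum,
    sum_bits_prod fun (v : (Sᶜ : Set V)) a => if a = 0 then 1 - q v else q v]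
  simp

lemma zNoise_add (q : V → ℝ) (κ μ : Bits V) :
    zNoise q (κ + μ) = zNoise (fun v => if μ v = 0 then q v else 1 - q v) κ := by
  refine Finset.prod_congr rfl fun v _ => ?_
  rcases zmod_two_cases (κ v) with h | h <;> rcases zmod_two_cases (μ v) with h' | h' <;>
    simp [h, h', one_add_one_zmod_two]

lemma zNoise_lt {q : V → ℝ} (h0 : ∀ v, 0 ≤ q v) (h1 : ∀ v, q v < 1 / 2) {μ : Bits V}
    (hμ : μ ≠ 0) : zNoise q μ < zNoise q 0 := by
  have hpos : 0 < zNoise q 0 := by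
    refine Finset.prod_pos fun v _ => ?_
    simp only [Pi.zero_apply, if_true]
    linarith [h1 v]
  -- The strict comparison of products below needs positive factors.
  by_cases hz : zNoise q μ = 0
  · rwa [hz]
  have hne := Finset.prod_ne_zero_iff.1 hz
  refine Finset.prod_lt_prod (fun v hv => lt_of_le_of_ne ?_ (hne v hv).symm) (fun v _ => ?_) ?_
  · split_ifs
    · linarith [h1 v]
    · exact h0 v
  · simp only [Pi.zero_apply, if_true]
    split_ifs
    · rfl
    · linarith [h1 v]
  · obtain ⟨v, hv⟩ := Function.ne_iff.1 hμ
    refine ⟨v, Finset.mem_univ _, ?_⟩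
    have hv : μ v ≠ 0 := hv
    simp only [Pi.zero_apply, if_true, hv, if_false]
    linarith [h1 v]

end Measurement

/-! ### Purification when only one colour carries errors. -/

section OneColour

variable {V : Type*} [Fintype V]

/-- Both factors vanish unless their patterns are zero off colour `k`, and on colour `k` they agree
with `μ`; only `ν = μ` survives. -/
lemma gmppSum_of_support {C : V → Bool} {k : Bool} {c : Bits V → ℝ}
    (hc : ∀ μ, c μ ≠ 0 → ∀ v, C v ≠ k → μ v = 0) : gmppSum C k c = fun μ => c μ ^ 2 := by
  funext μ
  rw [gmppSum, Finset.sum_eq_single μ]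
  · by_cases h : c μ = 0
    · simp [h]
    · have : (fun v => if C v = k then μ v else μ v + μ v) = μ := by
        funext v
        by_cases hv : C v = k
        · simp [hv]
        · simp [hv, hc μ h v hv]
      rw [this, sq]
  · intro ν hν hne
    by_contra hprod
    have hν := (Finset.mem_filter.1 hν).2
    have h1 := hc ν (left_ne_zero_of_mul hprod)
    have h2 := hc _ (right_ne_zero_of_mul hprod)
    refine hne (funext fun v => ?_)
    by_cases hv : C v = k
    · exact hν v hv
    · have := h2 v hv
      simp only [hv, if_false, h1 v hv, add_zero] at this
      rw [h1 v hv, this]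
  · intro h
    exact absurd (Finset.mem_filter.2 ⟨Finset.mem_univ _, fun _ _ => rfl⟩) h

lemma sumRun_of_support {C : V → Bool} {k : Bool} {c : Bits V → ℝ}
    (hc : ∀ μ, c μ ≠ 0 → ∀ v, C v ≠ k → μ v = 0) (n : ℕ) :
    sumRun C (List.replicate n k) c = fun μ => c μ ^ 2 ^ n := by
  induction n generalizing c with
  | zero => simp [sumRun]
  | succ n ih =>
    rw [List.replicate_succ, sumRun, List.foldl_cons, gmppSum_of_support hc]
    have h := ih (c := fun μ => c μ ^ 2) fun μ hμ => hc μ fun e => hμ (by simp [e])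
    rw [sumRun] at h
    rw [h]
    funext μ
    rw [← pow_mul, pow_succ']

lemma tendsto_coeffRun_of_support {C : V → Bool} {k : Bool} {c : Bits V → ℝ}
    (hd : IsDistribution c) (hc : ∀ μ, c μ ≠ 0 → ∀ v, C v ≠ k → μ v = 0)
    (hmax : ∀ μ, μ ≠ 0 → c μ < c 0) (μ : Bits V) :
    Filter.Tendsto (fun n => coeffRun C (List.replicate n k) c μ) Filter.atTop
      (nhds (if μ = 0 then 1 else 0)) := by
  have hle : ∀ κ, c κ ≤ c 0 := fun κ => by
    by_cases h : κ = 0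
    · rw [h]
    · exact (hmax κ h).le
  have h0 : 0 < c 0 := by
    by_contra! h
    have : ∑ κ, c κ ≤ 0 := Finset.sum_nonpos fun κ _ => (hle κ).trans h
    rw [hd.2] at this
    linarith
  have hlim : ∀ κ, Filter.Tendsto (fun n : ℕ => (c κ / c 0) ^ 2 ^ n) Filter.atTop
      (nhds (if κ = 0 then 1 else 0)) := by
    intro κ
    split_ifs with h
    · rw [h, div_self h0.ne']
      simp
    · exact (tendsto_pow_atTop_nhds_zero_of_lt_one (div_nonneg (hd.1 κ) h0.le)
        ((div_lt_one h0).2 (hmax κ h))).comp (tendsto_pow_atTop_atTop_of_one_lt one_lt_two)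
  have h := (hlim μ).div (tendsto_finsetSum Finset.univ fun κ _ => hlim κ) (by simp)
  simp only [Finset.sum_ite_eq', Finset.mem_univ, if_true, div_one] at h
  refine h.congr fun n => ?_
  rw [coeffRun_distribution C _ hd, sumRun_of_support hc]
  simp only [div_pow, ← Finset.sum_div, Pi.div_apply]
  exact div_div_div_cancel_right₀ (pow_ne_zero _ h0.ne') _ _

/-- The weights tend to a point mass at 0, whose transform is constantly 1. -/
lemma tendsto_fourier_of_support {C : V → Bool} {k : Bool} {c : Bits V → ℝ}
    (hd : IsDistribution c) (hc : ∀ μ, c μ ≠ 0 → ∀ v, C v ≠ k → μ v = 0)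
    (hmax : ∀ μ, μ ≠ 0 → c μ < c 0) (z : Bits V) :
    Filter.Tendsto (fun n => fourier (coeffRun C (List.replicate n k) c) z) Filter.atTop
      (nhds 1) := by
  have h := tendsto_finsetSum Finset.univ fun μ (_ : μ ∈ Finset.univ) =>
    ((Complex.continuous_ofReal.tendsto _).comp
      (tendsto_coeffRun_of_support hd hc hmax μ)).mul_const (chi μ z)
  have e : ∑ μ : Bits V, (((if μ = 0 then 1 else 0 : ℝ) : ℝ) : ℂ) * chi μ z = 1 := by
    rw [Finset.sum_eq_single 0] <;> simp +contextual
  rw [e] at h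
  exact h

end OneColour

/-! ### Merging pairs into the graph state. -/

section Rebuild

variable {V : Type*} [Fintype V] {G : SimpleGraph V}

/-- Merging identifies all bits held at a vertex, so the kernels multiply pointwise. -/
lemma merge_conj_apply (σ : ∀ e : G.edgeSet, Op (ends e)) (x y : Bits V) :
    (merge G * pairsState σ * (merge G).conjTranspose) x y =
      ∏ e, σ e (fun v => x v) (fun v => y v) := by
  have h : ∀ (x : Bits V) (t : ∀ e : G.edgeSet, Bits (ends e)),
      merge G x t = if t = fun (e : G.edgeSet) (v : ends e) => x v then 1 else 0 := by
    intro x t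
    simp only [merge, funext_iff]
  simp only [Matrix.mul_apply, Matrix.conjTranspose_apply, h, ite_mul, one_mul, zero_mul,
    Finset.sum_ite_eq', Finset.mem_univ, if_true, apply_ite star, star_one, star_zero, mul_ite,
    mul_one, mul_zero]
  rfl

lemma prod_phase_ends (C : G.Coloring Bool) (x : Bits V) :
    ∏ e : G.edgeSet, phase (G.induce (ends e)) (fun v => x v) = phase G x := by
  have h : ∀ e : G.edgeSet, phase (G.induce (ends e)) (fun v => x v) =
      if ∀ v ∈ (e : Sym2 V), x v = 1 then -1 else 1 := by
    intro e
    rw [← phase_glue_zero C, phase, Finset.prod_eq_single (e : Sym2 V)]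
    · have : (∀ v ∈ (e : Sym2 V), glue (ends e) (fun v => x v) 0 v = 1) ↔
          ∀ v ∈ (e : Sym2 V), x v = 1 :=
        forall₂_congr fun v hv => by
          rw [glue_mem (S := ends e) (fun v => x v) 0 ⟨v, hv⟩]
      simp only [this]
    -- An edge on which the glued string is 1 lies inside `ends e`, hence equals `e`.
    · intro e' he' hne
      refine if_neg fun hall => hne ?_
      have hsub : ∀ v ∈ e', v ∈ (e : Sym2 V) := by
        intro v hv
        by_contra hn
        have h1 := hall v hv
        rw [glue_compl (S := ends e) (fun v => x v) 0 ⟨v, hn⟩] at h1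
        exact zero_ne_one h1
      revert hsub
      induction e' using Sym2.ind with
      | _ a b =>
        intro hsub
        have hab : G.Adj a b := by simpa using he'
        exact ((Sym2.mem_and_mem_iff hab.ne).1
          ⟨hsub a (Sym2.mem_mk_left a b), hsub b (Sym2.mem_mk_right a b)⟩).symm
    · intro hn
      exact absurd (by simp) hn
  rw [Finset.prod_congr rfl fun e _ => h e, phase]
  exact (Finset.prod_subtype (p := fun e => e ∈ G.edgeSet) G.edgeFinset (fun e => by simp)
    fun e => if ∀ v ∈ e, x v = 1 then -1 else 1).symm

lemma fidelity_rebuild (C : G.Coloring Bool) (d : ∀ e : G.edgeSet, Bits (ends e) → ℝ) :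
    fidelity (graphState G) (rebuild fun e => graphDiagonal (G.induce (ends e)) (d e)) =
      ((∑ z : Bits V, ∏ e, fourier (d e) fun v => z v) /
        (2 ^ Fintype.card V * ∏ e, fourier (d e) 0)).re := by
  set K : ℂ := ∏ e : G.edgeSet, (2 ^ Fintype.card (ends e))⁻¹ with hK
  have hK0 : K ≠ 0 := Finset.prod_ne_zero_iff.2 fun e _ => inv_ne_zero (pow_ne_zero _ two_ne_zero)
  have h : ∀ x y, (merge G * pairsState (fun e => graphDiagonal (G.induce (ends e)) (d e)) *
      (merge G).conjTranspose) x y =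
      K * (phase G x * phase G y) * ∏ e, fourier (d e) fun v => (x + y) v := by
    intro x y
    rw [merge_conj_apply]
    simp only [graphDiagonal_apply, Finset.prod_mul_distrib, prod_phase_ends C]
    rfl
  have ht : (merge G * pairsState (fun e => graphDiagonal (G.induce (ends e)) (d e)) *
      (merge G).conjTranspose).trace = K * (2 ^ Fintype.card V * ∏ e, fourier (d e) 0) := by
    simp only [Matrix.trace, Matrix.diag_apply, h, phase_mul_self, bits_add_self]
    rw [Finset.sum_const, Finset.card_univ, card_bits, nsmul_eq_mul]
    push_cast
    rw [mul_one, mul_left_comm]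
    rfl
  rw [fidelity_graphState G (fun z => ∏ e, fourier (d e) fun v => z v)
    ((K * (2 ^ Fintype.card V * ∏ e, fourier (d e) 0))⁻¹ * K)]
  · congr 1
    rw [mul_inv, mul_right_comm K⁻¹, inv_mul_cancel₀ hK0, one_mul, div_eq_inv_mul]
  · intro x y
    rw [rebuild, normalize, Matrix.smul_apply, ht, h, smul_eq_mul]
    ring

lemma tendsto_fidelity_rebuild (C : G.Coloring Bool)
    (d : ℕ → ∀ e : G.edgeSet, Bits (ends e) → ℝ)
    (hd : ∀ e z, Filter.Tendsto (fun n => fourier (d n e) z) Filter.atTop (nhds 1)) :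
    Filter.Tendsto (fun n => fidelity (graphState G)
      (rebuild fun e => graphDiagonal (G.induce (ends e)) (d n e))) Filter.atTop (nhds 1) := by
  simp only [fidelity_rebuild C]
  have h1 : Filter.Tendsto (fun n => ∑ z : Bits V, ∏ e, fourier (d n e) fun v => z v) Filter.atTop
      (nhds (∑ _z : Bits V, ∏ _e : G.edgeSet, 1)) :=
    tendsto_finsetSum _ fun z _ => tendsto_finsetProd _ fun e _ => hd e _
  have h2 : Filter.Tendsto (fun n => 2 ^ Fintype.card V * ∏ e, fourier (d n e) 0) Filter.atTop
      (nhds (2 ^ Fintype.card V * ∏ _e : G.edgeSet, (1 : ℂ))) :=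
    (tendsto_finsetProd _ fun e _ => hd e _).const_mul _
  have h := (Complex.continuous_re.tendsto _).comp (h1.div h2 (by simp))
  have e : ((∑ _z : Bits V, ∏ _e : G.edgeSet, (1 : ℂ)) /
      (2 ^ Fintype.card V * ∏ _e : G.edgeSet, (1 : ℂ))).re = 1 := by
    simp
  rw [e] at h
  exact h

lemma purifiedPair_zNoise (C : G.Coloring Bool) (q : V → ℝ) (e : G.edgeSet) (μ : Bits (ends e))
    (w : List Bool) :
    purifiedPair C (graphDiagonal G (zNoise q)) e μ w =
      graphDiagonal (G.induce (ends e)) (coeffRun (edgeColoring C e) w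
        (zNoise fun v : ends e => if μ v = 0 then q v else 1 - q v)) := by
  rw [purifiedPair, measureOut_graphDiagonal_inst C, pauliZ_conj_graphDiagonal, gmppRun_graphDiagonal,
    marginal_zNoise]
  congr 2
  funext κ
  exact zNoise_add _ _ _

/-- `μ` encodes the rotations that bring all error rates below 1/2, and `k e` is the only colour on
which the pair at `e` may carry errors. -/
lemma drppPurifies_zNoise (C : G.Coloring Bool) {q : V → ℝ} (μ : Bits V)
    (k : G.edgeSet → Bool) (h0 : ∀ v, 0 ≤ if μ v = 0 then q v else 1 - q v)
    (h1 : ∀ v, (if μ v = 0 then q v else 1 - q v) < 1 / 2)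
    (hk : ∀ e : G.edgeSet, ∀ v ∈ (e : Sym2 V), C v ≠ k e →
      (if μ v = 0 then q v else 1 - q v) = 0) :
    DRPPPurifies C (graphDiagonal G (zNoise q)) := by
  intro ε hε
  have h := tendsto_fidelity_rebuild C
    (fun n e => coeffRun (edgeColoring C e) (List.replicate n (k e))
      (zNoise fun v : ends e => if μ v = 0 then q v else 1 - q v)) (fun e z => by
        refine tendsto_fourier_of_support (V := ends e) (C := edgeColoring C e)
          (isDistribution_zNoise (fun v => h0 v) fun v => (h1 v).le.trans (by norm_num)) (fun κ hκ v hv => ?_)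
          (fun κ hκ => zNoise_lt (V := ends e) (fun v => h0 v) (fun v => h1 v) hκ) z
        by_contra hne
        have hf := Finset.prod_ne_zero_iff.1 hκ v (Finset.mem_univ _)
        rw [if_neg hne] at hf
        exact hf (hk e v v.2 hv))
  obtain ⟨n, hn⟩ := (h.eventually (lt_mem_nhds (by linarith : 1 - ε < 1))).exists
  refine ⟨fun e v => μ v, fun e => List.replicate n (k e), ?_⟩
  simp only [purifiedPair_zNoise]
  exact hn

end Rebuild

lemma drppPurifies_noisyChain (C : chain.Coloring Bool) {p : ℝ} (h0 : 0 ≤ p) (h1 : p ≤ 1)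
    (hp : p ≠ 1 / 2) : DRPPPurifies C (noisyChain p) := by
  set μ : Bits (Fin 4) := fun v => if (v = 0 ∨ v = 3) ∧ 1 / 2 < p then 1 else 0 with hμ
  have hq : ∀ v, (if μ v = 0 then (if v = 0 ∨ v = 3 then p else 0) else
      1 - (if v = 0 ∨ v = 3 then p else 0)) = if v = 0 ∨ v = 3 then min p (1 - p) else 0 := by
    intro v
    by_cases hv : v = 0 ∨ v = 3
    · by_cases hp' : 1 / 2 < p
      · simp only [hμ, hv, hp', and_self, if_true, one_ne_zero, if_false]
        rw [min_eq_right (by linarith)]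
      · simp only [hμ, hv, hp', and_false, if_true, if_false]
        rw [min_eq_left (by linarith)]
    · simp only [hμ, hv, false_and, if_true, if_false]
  refine drppPurifies_zNoise C μ (fun e => if (0 : Fin 4) ∈ (e : Sym2 (Fin 4)) then C 0 else C 3)
    (fun v => ?_) (fun v => ?_) (fun e v hv hC => ?_) <;> rw [hq]
  · split_ifs
    · exact le_min h0 (by linarith)
    · exact le_rfl
  · split_ifs
    · rcases lt_or_gt_of_ne hp with h | h
      · exact (min_le_left _ _).trans_lt h
      · exact (min_le_right _ _).trans_lt (by linarith)
    · norm_num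
  · refine if_neg ?_
    rintro (rfl | rfl)
    · rw [if_pos hv] at hC
      exact hC rfl
    · split_ifs at hC with h
      -- An edge with two noisy ends would join the two ends of the chain.
      · have he : (e : Sym2 (Fin 4)) = s(0, 3) := (Sym2.mem_and_mem_iff (by decide)).1 ⟨h, hv⟩
        have hadj := e.2
        rw [he, SimpleGraph.mem_edgeSet, SimpleGraph.pathGraph_adj] at hadj
        revert hadj
        decide
      · exact hC rfl

/-! ### Product operators on many copies. -/

section Filters

variable {V : Type*} [Fintype V]

/-- The tensor product of one-qubit operators. -/
def localOp (k : V → ZMod 2 → ZMod 2 → ℂ) : Op V := fun t y => ∏ v, k v (t v) (y v)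

/-- The entrywise power of a matrix. -/
def entryPow {m : Type*} (n : ℕ) (ρ : Matrix m m ℂ) : Matrix m m ℂ := fun x y => ρ x y ^ n

lemma productOp_comp {n : ℕ} (W k : V → ZMod 2 → ZMod 2 → ℂ) :
    productOp (fun v x (y : Fin n → ZMod 2) => ∑ t, W v x t * ∏ j, k v t (y j)) =
      localOp W * productOp fun v t (y : Fin n → ZMod 2) => ∏ j, k v t (y j) := by
  ext x y
  rw [Matrix.mul_apply]
  simp only [productOp, localOp, ← Finset.prod_mul_distrib]
  rw [Finset.prod_univ_sum, Fintype.piFinset_univ]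

/-- `k` acts on each copy and then each party projects its `n` qubits onto equal values `t v`; the
amplitudes of the copies multiply. -/
lemma productOp_conj_copies (n : ℕ) (ρ : Op V) (k : V → ZMod 2 → ZMod 2 → ℂ) :
    productOp (fun v t (y : Fin n → ZMod 2) => ∏ j, k v t (y j)) * copies n ρ *
      (productOp fun v t (y : Fin n → ZMod 2) => ∏ j, k v t (y j)).conjTranspose =
    entryPow n (localOp k * ρ * (localOp k).conjTranspose) := by
  ext t t'
  simp only [Matrix.mul_apply, Matrix.conjTranspose_apply, Finset.sum_mul, entryPow]
  rw [← Fintype.sum_prod_type' fun (b a : Bits V) => localOp k t a * ρ a b * star (localOp k t' b),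
    Fintype.sum_pow, ← Fintype.sum_prod_type' fun (y' y : V → Fin n → ZMod 2) =>
      productOp (fun v t (y : Fin n → ZMod 2) => ∏ j, k v t (y j)) t y * copies n ρ y y' *
        star (productOp (fun v t (y : Fin n → ZMod 2) => ∏ j, k v t (y j)) t' y')]
  let E : (V → Fin n → ZMod 2) × (V → Fin n → ZMod 2) ≃ (Fin n → Bits V × Bits V) :=
    (Equiv.prodCongr (Equiv.piComm _) (Equiv.piComm _)).trans
      (Equiv.arrowProdEquivProdArrow _ _ _).symm
  refine Fintype.sum_equiv E _ _ fun q => ?_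
  have h : ∀ (t : Bits V) (y : V → Fin n → ZMod 2),
      productOp (fun v t (y : Fin n → ZMod 2) => ∏ j, k v t (y j)) t y =
        ∏ j, localOp k t fun v => y v j := fun t y => Finset.prod_comm
  simp only [h, copies, star_prod, ← Finset.prod_mul_distrib]
  rfl

/-- Purification by a single product operator, built from one-qubit operators. -/
lemma sloccPurifies_of_localOp {ψ : Bits V → ℂ} {ρ : Op V} (W k : V → ZMod 2 → ZMod 2 → ℂ)
    (h : ∀ ε : ℝ, 0 < ε → ∃ n : ℕ, 1 - ε < fidelity ψ (normalize (localOp W *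
      entryPow n (localOp k * ρ * (localOp k).conjTranspose) * (localOp W).conjTranspose))) :
    SLOCCPurifies ψ ρ := by
  intro ε hε
  obtain ⟨n, hn⟩ := h ε hε
  refine ⟨n, 1, fun _ v x y => ∑ t, W v x t * ∏ j, k v t (y j), ?_⟩
  rw [Finset.univ_unique, Finset.sum_singleton, productOp_comp, Matrix.conjTranspose_mul,
    ← Matrix.mul_assoc]
  rw [← productOp_conj_copies] at hn
  simpa only [Matrix.mul_assoc] using hn

end Filters

/-! ### An SLOCC filter for the noisy chain. -/

section ChainFilter

lemma phase_chain (x : Bits (Fin 4)) : phase chain x = sgn (x 0 * x 1 + x 1 * x 2 + x 2 * x 3) := by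
  let C : chain.Coloring Bool := SimpleGraph.pathGraph.bicoloring 4
  obtain ⟨h1, h2, h3⟩ := chain_coloring C
  rw [phase_eq_sgn C (C 0)]
  congr 1
  simp [quadForm, Fin.sum_univ_four, h1, h2, h3, SimpleGraph.pathGraph_adj]
  ring

lemma fourier_chainTable (f : ZMod 2 → ZMod 2 → ℝ) (z : Bits (Fin 4)) :
    fourier (chainTable f) z = ∑ i, ∑ j, (f i j : ℂ) * (sgn (i * z 0) * sgn (j * z 3)) := by
  simp [fourier, chi, sum_fin_four, sum_zmod_two, chainTable, Fin.sum_univ_four, sgn_add]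

/-- The Kronecker delta. -/
def kdelta (a b : ZMod 2) : ℂ := if a = b then 1 else 0

lemma kdelta_swap (a b c d : ZMod 2) : kdelta a (b + c + d) = kdelta b (a + c + d) := by
  have h : a = b + c + d ↔ b = a + c + d := by revert a b c d; decide
  simp only [kdelta, h]

lemma sum_mul_kdelta (a : ZMod 2) (F : ZMod 2 → ℂ) : ∑ b, kdelta b a * F b = F a := by
  simp [kdelta]

/-- On the end qubits an `X`-measurement (shifted by `s`), on the inner qubits the identity. -/
def endFilter (s : ZMod 2) (v : Fin 4) (t a : ZMod 2) : ℂ :=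
  if v = 0 ∨ v = 3 then sgn ((t + s) * a) else kdelta a t

lemma localOp_endFilter (s : ZMod 2) (t y : Bits (Fin 4)) :
    localOp (endFilter s) t y = kdelta (y 1) (t 1) * (kdelta (y 2) (t 2) *
      (sgn ((t 0 + s) * y 0) * sgn ((t 3 + s) * y 3))) := by
  simp [localOp, Fin.prod_univ_four, endFilter]
  ring

lemma star_localOp_endFilter (s : ZMod 2) (t y : Bits (Fin 4)) :
    star (localOp (endFilter s) t y) = localOp (endFilter s) t y := by
  have h : ∀ a b, star (kdelta a b) = kdelta a b := fun a b => by
    simp only [kdelta, apply_ite star, star_one, star_zero]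
  rw [localOp_endFilter, star_mul, star_mul, star_mul, star_sgn, star_sgn, h, h]
  ring

/-- A graph state basis vector of the chain after the filter. -/
def filtered (s i j : ZMod 2) (t : Bits (Fin 4)) : ℂ :=
  kdelta i (t 0 + t 1 + s) * (kdelta j (t 3 + t 2 + s) * sgn (t 1 * t 2))

lemma localOp_endFilter_conj_apply {inst : Fintype (Bits (Fin 4))} (s : ZMod 2) (ρ : Op (Fin 4))
    (f : ZMod 2 → ZMod 2 → ℂ) (u : ZMod 2 → ZMod 2 → Bits (Fin 4) → ℂ)
    (hρ : ∀ y y', ρ y y' = ∑ i, ∑ j, f i j * (u i j y * u i j y')) (t t' : Bits (Fin 4)) :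
    (localOp (endFilter s) * ρ * (localOp (endFilter s)).conjTranspose) t t' =
      ∑ i, ∑ j, f i j * ((∑ y, localOp (endFilter s) t y * u i j y) *
        ∑ y, localOp (endFilter s) t' y * u i j y) := by
  simp only [Matrix.mul_apply, Matrix.conjTranspose_apply, star_localOp_endFilter, hρ,
    Finset.sum_mul_sum]
  simp only [sum_zmod_two, mul_add, add_mul, Finset.sum_add_distrib, Finset.sum_mul,
    Finset.mul_sum]
  refine congrArg₂ (· + ·) (congrArg₂ (· + ·) ?_ ?_) (congrArg₂ (· + ·) ?_ ?_) <;>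
    rw [Finset.sum_comm] <;>
    exact Finset.sum_congr rfl fun _ _ => Finset.sum_congr rfl fun _ _ => by ring

/-- The sums over the end bits are character sums: the error bits `i`, `j` become the parities `t 0
+ t 1 + s` and `t 3 + t 2 + s`. -/
lemma sum_localOp_mul_phase {inst : Fintype (Bits (Fin 4))} (s i j : ZMod 2) (t : Bits (Fin 4)) :
    ∑ y, localOp (endFilter s) t y * (phase chain y * (sgn (i * y 0) * sgn (j * y 3))) =
      4 * filtered s i j t := by
  have e : ∀ a d, sgn ((t 0 + s) * a) * sgn ((t 3 + s) * d) *
      (sgn (a * t 1 + t 1 * t 2 + t 2 * d) * (sgn (i * a) * sgn (j * d))) =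
      sgn ((t 0 + t 1 + s + i) * a) * (sgn ((t 3 + t 2 + s + j) * d) * sgn (t 1 * t 2)) := by
    intro a d
    simp only [← sgn_add]
    congr 1
    ring
  have hz : ∀ a b : ZMod 2, a + b = 0 ↔ b = a := by decide
  have hd : ∀ a b : ZMod 2, ∑ c, sgn ((a + b) * c) = 2 * kdelta b a := fun a b => by
    simp only [sum_sgn_mul, hz, kdelta, mul_ite, mul_one, mul_zero]
  simp only [sum_fin_four, localOp_endFilter, phase_chain, Matrix.cons_val, mul_assoc (kdelta _ _),
    ← Finset.mul_sum, sum_mul_kdelta, e, ← Finset.sum_mul, hd, filtered]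
  ring

lemma sum_localOp_mul_filtered {inst : Fintype (Bits (Fin 4))} (s i j : ZMod 2)
    (x : Bits (Fin 4)) :
    ∑ t, localOp (endFilter 0) x t * filtered s i j t =
      phase chain x * (sgn ((i + s) * x 0) * sgn ((j + s) * x 3)) := by
  have e : ∀ a b c d : ZMod 2, kdelta b (x 1) * (kdelta c (x 2) *
      (sgn ((x 0 + 0) * a) * sgn ((x 3 + 0) * d))) * (kdelta i (a + b + s) *
        (kdelta j (d + c + s) * sgn (b * c))) = kdelta a (i + b + s) * (kdelta b (x 1) *
          (kdelta c (x 2) * (kdelta d (j + c + s) * sgn (x 0 * a + x 3 * d + b * c)))) := by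
    intro a b c d
    rw [kdelta_swap i, kdelta_swap j, sgn_add, sgn_add, add_zero, add_zero]
    ring
  simp only [sum_fin_four, localOp_endFilter, phase_chain, filtered, Matrix.cons_val, e]
  rw [Finset.sum_comm]
  simp only [← Finset.mul_sum, sum_mul_kdelta, ← sgn_add]
  congr 1
  ring

/-- For given `t` only one pair `(i, j)` contributes, so the power passes inside the sum; an odd
exponent preserves signs. -/
lemma filtered_conj_pow (f : ZMod 2 → ZMod 2 → ℂ) (s : ZMod 2) (t t' : Bits (Fin 4)) (N : ℕ) :
    (∑ i, ∑ j, f i j * (filtered s i j t * filtered s i j t')) ^ (2 * N + 1) =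
      ∑ i, ∑ j, f i j ^ (2 * N + 1) * (filtered s i j t * filtered s i j t') := by
  have h : ∀ g : ZMod 2 → ZMod 2 → ℂ,
      ∑ i, ∑ j, g i j * (filtered s i j t * filtered s i j t') =
        g (t 0 + t 1 + s) (t 3 + t 2 + s) * (kdelta (t 0 + t 1 + s) (t' 0 + t' 1 + s) *
          (kdelta (t 3 + t 2 + s) (t' 3 + t' 2 + s) * sgn (t 1 * t 2 + t' 1 * t' 2))) := by
    intro g
    have e : ∀ i j, g i j * (filtered s i j t * filtered s i j t') =
        kdelta i (t 0 + t 1 + s) * (kdelta j (t 3 + t 2 + s) * (g i j *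
          (kdelta i (t' 0 + t' 1 + s) * (kdelta j (t' 3 + t' 2 + s) *
            sgn (t 1 * t 2 + t' 1 * t' 2))))) := by
      intro i j
      rw [sgn_add, filtered, filtered]
      ring
    simp only [e, ← Finset.mul_sum, sum_mul_kdelta]
  have hs : ∀ a : ZMod 2, sgn a ^ (2 * N + 1) = sgn a := fun a => by
    rw [pow_succ, pow_mul, sq, sgn_mul_self, one_pow, one_mul]
  have hk : ∀ a b, kdelta a b ^ (2 * N + 1) = kdelta a b := fun a b => by
    unfold kdelta
    split_ifs <;> simp
  rw [h, h, mul_pow, mul_pow, mul_pow, hs, hk, hk]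

/-- The filter makes the components disjoint in the computational basis, the power acts on their
weights, and the second filter restores the graph state basis. The shift `s` relabels the errors,
and 16 is the missing normalization of four qubits. -/
lemma endFilter_graphDiagonal {inst : Fintype (Bits (Fin 4))} (f : ZMod 2 → ZMod 2 → ℝ)
    (s : ZMod 2) (N : ℕ) :
    localOp (endFilter 0) * entryPow (2 * N + 1) (localOp (endFilter s) *
      graphDiagonal chain (chainTable f) * (localOp (endFilter s)).conjTranspose) *
      (localOp (endFilter 0)).conjTranspose =
    (16 : ℂ) • graphDiagonal chain (chainTable fun i j => f (i + s) (j + s) ^ (2 * N + 1)) := by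
  have h1 : ∀ y y', graphDiagonal chain (chainTable f) y y' = ∑ i, ∑ j, ((f i j : ℂ) * 16⁻¹) *
      ((phase chain y * (sgn (i * y 0) * sgn (j * y 3))) *
        (phase chain y' * (sgn (i * y' 0) * sgn (j * y' 3)))) := by
    intro y y'
    rw [graphDiagonal_apply, fourier_chainTable, Finset.mul_sum]
    refine Finset.sum_congr rfl fun i _ => ?_
    rw [Finset.mul_sum]
    refine Finset.sum_congr rfl fun j _ => ?_
    rw [Pi.add_apply, Pi.add_apply, mul_add, mul_add, sgn_add, sgn_add, Fintype.card_fin]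
    ring
  have h2 : ∀ t t', entryPow (2 * N + 1) (localOp (endFilter s) *
      graphDiagonal chain (chainTable f) * (localOp (endFilter s)).conjTranspose) t t' =
      ∑ i, ∑ j, (f i j : ℂ) ^ (2 * N + 1) * (filtered s i j t * filtered s i j t') := by
    intro t t'
    rw [entryPow, localOp_endFilter_conj_apply s _ _ _ h1]
    simp only [sum_localOp_mul_phase]
    rw [← filtered_conj_pow]
    congr 1
    refine Finset.sum_congr rfl fun i _ => Finset.sum_congr rfl fun j _ => ?_
    ring
  ext x x'
  rw [localOp_endFilter_conj_apply 0 _ _ _ h2, Matrix.smul_apply, graphDiagonal_apply,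
    fourier_chainTable, Fintype.card_fin, smul_eq_mul]
  simp only [sum_localOp_mul_filtered]
  rw [← Equiv.sum_comp (Equiv.addRight s), Finset.mul_sum, Finset.mul_sum]
  refine Finset.sum_congr rfl fun i _ => ?_
  rw [← Equiv.sum_comp (Equiv.addRight s), Finset.mul_sum, Finset.mul_sum]
  refine Finset.sum_congr rfl fun j _ => ?_
  simp only [Equiv.coe_addRight, add_assoc, zmod_two_add_self, add_zero, Pi.add_apply, mul_add,
    sgn_add, Complex.ofReal_pow]
  ring

lemma sloccPurifies_noisyChain {p : ℝ} (h0 : 0 ≤ p) (h1 : p ≤ 1) (hp : p ≠ 1 / 2) :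
    SLOCCPurifies (graphState chain) (noisyChain p) := by
  -- The shift moves the larger of `p` and `1 - p` to the label 0.
  set s : ZMod 2 := if p < 1 / 2 then 0 else 1 with hs
  set h : ZMod 2 → ℝ := fun i => if i + s = 0 then 1 - p else p with hh
  obtain ⟨hpos, hlt, hnn⟩ : 0 < h 0 ∧ h 1 < h 0 ∧ 0 ≤ h 1 := by
    rcases lt_or_gt_of_ne hp with hlt | hgt
    · simp only [hh, hs, hlt, if_true, add_zero, one_ne_zero, if_false]
      refine ⟨?_, ?_, ?_⟩ <;> linarith
    · have hn : ¬ p < 1 / 2 := by linarith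
      simp only [hh, hs, hn, if_false, zero_add, one_ne_zero, one_add_one_zmod_two, if_true]
      refine ⟨?_, ?_, ?_⟩ <;> linarith
  refine sloccPurifies_of_localOp (endFilter 0) (endFilter s) fun ε hε => ?_
  have hlim : Filter.Tendsto (fun N : ℕ => (1 + (h 1 / h 0) ^ (2 * N + 1))⁻¹ ^ 2) Filter.atTop
      (nhds 1) := by
    have hm : Filter.Tendsto (fun N : ℕ => 2 * N + 1) Filter.atTop Filter.atTop :=
      Filter.tendsto_atTop_mono (fun N => by simp only [id]; omega) Filter.tendsto_id
    have := (((tendsto_pow_atTop_nhds_zero_of_lt_one (div_nonneg hnn hpos.le)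
      ((div_lt_one hpos).2 hlt)).comp hm).const_add 1).inv₀ (by norm_num)
    simpa using this.pow 2
  obtain ⟨N, hN⟩ := (hlim.eventually (lt_mem_nhds (by linarith : 1 - ε < 1))).exists
  refine ⟨2 * N + 1, ?_⟩
  rw [noisyChain_eq, endFilter_graphDiagonal, normalize_smul _ (by norm_num),
    normalize_graphDiagonal, fidelity_graphDiagonal, chainTable_zero, sum_chainTable]
  refine hN.trans_eq ?_
  have hf : ∀ i j, noiseTable p (i + s) (j + s) = h i * h j := fun _ _ => rfl
  simp only [total, hf]
  have : h 0 ^ (2 * N + 1) ≠ 0 := pow_ne_zero _ hpos.ne'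
  have : h 0 ^ (2 * N + 1) + h 1 ^ (2 * N + 1) ≠ 0 :=
    (add_pos_of_pos_of_nonneg (pow_pos hpos _) (pow_nonneg hnn _)).ne'
  have e : h 0 ^ (2 * N + 1) * h 0 ^ (2 * N + 1) + h 0 ^ (2 * N + 1) * h 1 ^ (2 * N + 1) +
      (h 1 ^ (2 * N + 1) * h 0 ^ (2 * N + 1) + h 1 ^ (2 * N + 1) * h 1 ^ (2 * N + 1)) =
      (h 0 ^ (2 * N + 1) + h 1 ^ (2 * N + 1)) ^ 2 := by ring
  simp only [mul_pow]
  rw [e, div_pow]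
  field_simp

end ChainFilter

lemma criticalFidelity_lt (C : chain.Coloring Bool) :
    criticalFidelity (SLOCCPurifies (graphState chain)) < criticalFidelity (GMPPPurifies C) := by
  have hr : (1 / √2) ^ 2 = (1 / 2 : ℝ) := by rw [div_pow, Real.sq_sqrt (by norm_num), one_pow]
  have hr0 : 0 < 1 / √2 := by positivity
  -- Any `p` strictly between `1 - 1/√2` and 1/2 would do; `p = 2/5` gives `(3/5)^2`.
  have h1 : criticalFidelity (SLOCCPurifies (graphState chain)) ≤ 9 / 25 := by
    refine csInf_le ⟨0, ?_⟩ ⟨2 / 5, by norm_num, by norm_num,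
      sloccPurifies_noisyChain (by norm_num) (by norm_num) (by norm_num), ?_⟩
    · rintro f ⟨p, -, -, -, rfl⟩
      rw [fidelity_noisyChain]
      positivity
    · rw [fidelity_noisyChain]
      norm_num
  -- The set must be nonempty, since the real infimum of the empty set is 0; `p = 0` is a member.
  have h2 : 1 / 2 ≤ criticalFidelity (GMPPPurifies C) := by
    refine le_csInf ⟨_, 0, le_rfl, by norm_num, ?_, rfl⟩ ?_
    · refine (gmppPurifies_noisyChain C le_rfl zero_le_one).2 (Or.inl ?_)
      nlinarith
    · rintro f ⟨p, hp0, hp1, hP, rfl⟩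
      rw [fidelity_noisyChain]
      rcases (gmppPurifies_noisyChain C hp0 (by linarith)).1 hP with h | h
      · nlinarith
      · nlinarith
  linarith

end GraphPurification

end

open GraphPurification in
theorem mainTheorem5 :
    -- the two sub-protocols act on the diagonal elements by a rule in which no graph enters
    (∀ (V : Type*) [Fintype V] (G : SimpleGraph V) (C : G.Coloring Bool) (k : Bool)
      (c : Bits V → ℝ), IsDistribution c →
        gmppStep C k (graphDiagonal G c) = graphDiagonal G (gmppCoeff C k c)) ∧
    -- geometry independence of the GMPP
    (∀ (V W : Type*) [Fintype V] [Fintype W] (G : SimpleGraph V) (H : SimpleGraph W)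
      (C : G.Coloring Bool) (D : H.Coloring Bool) (e : V ≃ W), (∀ v, D (e v) = C v) →
      ∀ c : Bits V → ℝ, IsDistribution c →
        (GMPPPurifies C (graphDiagonal G c) ↔
          GMPPPurifies D (graphDiagonal H fun κ => c fun v => κ (e v)))) ∧
    -- the GMPP on the noisy chain
    (∀ (C : chain.Coloring Bool) (p : ℝ), 0 ≤ p → p ≤ 1 →
      (GMPPPurifies C (noisyChain p) ↔ p < 1 - 1 / √2 ∨ 1 / √2 < p)) ∧
    -- the DRPP on the noisy chain
    (∀ (C : chain.Coloring Bool) (p : ℝ), 0 ≤ p → p ≤ 1 → p ≠ 1 / 2 →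
      DRPPPurifies C (noisyChain p) ∧ SLOCCPurifies (graphState chain) (noisyChain p)) ∧
    -- the GMPP is not optimal
    (∀ C : chain.Coloring Bool,
      criticalFidelity (SLOCCPurifies (graphState chain)) < criticalFidelity (GMPPPurifies C)) :=
  ⟨fun _ _ _ C k c _ => gmppStep_graphDiagonal C k c,
    fun _ _ _ _ _ _ C D e h c _ => gmppPurifies_transport C D e h c,
    fun C _ h0 h1 => gmppPurifies_noisyChain C h0 h1,
    fun C _ h0 h1 hp => ⟨drppPurifies_noisyChain C h0 h1 hp, sloccPurifies_noisyChain h0 h1 hp⟩,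
    criticalFidelity_lt⟩
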